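/- **Setup.** Let $\mathbb H$ be the upper half-plane and $\mathcal O(\mathbb H)$ the algebra of holomorphic functions on it. For $\tau\in\mathbb H$ and $q=e^{2\pi i\tau}$ put $$\theta_\tau(\xi)=\sum_{n\in\mathbb Z}(-1)^n q^{\frac12(n+\frac12)^2}e^{(n+\frac12)2\pi i\xi},\qquad F_\tau(\xi,\alpha)=\frac{\theta_\tau'(0)\,\theta_\tau(\xi+\alpha)}{\theta_\tau(\xi)\,\theta_\tau(\alpha)},$$ and let $f^{(k)}(\xi)$, $k\ge 0$, be the coefficients of the expansion at $\alpha=0$ $$e^{2\pi i r\alpha}F_\tau(\xi,\alpha)=\sum_{k\ge 0}f^{(k)}(\xi)\,\alpha^{k-1},\qquad r=\operatorname{Im}\xi/\operatorname{Im}\tau .$$ In $\mathbb C\langle\langle x,y\rangle\rangle$ (formal power series in two non-commuting variables, $\mathrm{ad}(x)(u)=xu-ux$) let $J_\tau=\sum_{k\ge 0}f^{(k)}(\xi)\,\mathrm{ad}^k(x)(y)\,d\xi$ and, for $0<t<\frac12$, let $$\exp\Big[\int_t^{1-t}J_\tau\Big]=1+\sum_{k\ge1}\ \int_{t<t_1<\dots<t_k<1-t}J_\tau(t_1)\cdots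 J_\tau(t_k)$$ be the generating series of iterated integrals along the real segment $[t,1-t]$. The regularized generating series is the coefficientwise limit $$R(\tau)=\lim_{t\to0^+}(-2\pi i t)^{\mathrm{ad}(x)(y)}\exp\Big[\int_t^{1-t}J_\tau\Big](-2\pi i t)^{-\mathrm{ad}(x)(y)},$$ with the principal branch of $\log(-2\pi i t)$. For $r\ge0$ and $n_1,\dots,n_r\ge0$ the A-elliptic multiple zeta value $I^A(n_1,\dots,n_r;\tau)$, of length $r$ and weight $n_1+\dots+n_r$, is the coefficient of $\mathrm{ad}^{n_1}(x)(y)\cdots\mathrm{ad}^{n_r}(x)(y)$ in $R(\tau)$. Let $\mathcal{EZ}^A$, $\mathcal{EZ}^A_N$, $\mathcal L_l\mathcal{EZ}^A$ and $\mathcal L_l\mathcal{EZ}^A_N$ be the $\mathbb Q$-spans of, respectively, all functions $I^A(n_1,\dots,n_r;\tau)$ of $\tau$, those of weight $N$, those of length at most $l$, and those of weight $N$ and length at most $l$. **Proposition.** 1. The functions $I^A(n_1,\dots,n_r;\tau)$ are well defined: for every $\tau\in\mathbb H$ the limit $R(\tau)$ exists, and $R(\tau)$ has one and only one expansion $\sum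 c(n_1,\dots,n_r)\,\mathrm{ad}^{n_1}(x)(y)\cdots\mathrm{ad}^{n_r}(x)(y)$, the sum being over all $r\ge 0$ and $n_1,\dots,n_r\ge0$. They satisfy the shuffle product formula: for all finite sequences $u,v$ of non-negative integers, $I^A(u;\tau)\,I^A(v;\tau)=\sum_w I^A(w;\tau)$, where $w$ runs over all shuffles of $u$ and $v$, counted with multiplicity. 2. $\mathcal{EZ}^A$ is a $\mathbb Q$-subalgebra of $\mathcal O(\mathbb H)$. 3. $\mathcal{EZ}^A$ is a filtered $\mathbb Q$-algebra for the length: for all $l,l',N,N'\ge0$, $$\mathcal L_l\mathcal{EZ}^A_N\cdot\mathcal L_{l'}\mathcal{EZ}^A_{N'}\subset\mathcal L_{l+l'}\mathcal{EZ}^A_{N+N'}.$$ For each $N$ the spaces $\mathcal L_l\mathcal{EZ}^A_N$, $l\ge0$, increase with $l$ and have union $\mathcal{EZ}^A_N$. The spaces $\mathcal L_l\mathcal{EZ}^A$, $l\ge0$, increase with $l$ and have union $\mathcal{EZ}^A$, $1\in\mathcal L_0\mathcal{EZ}^A$, and $\mathcal L_l\mathcal{EZ}^A\cdot\mathcal L_{l'}\mathcal{EZ}^A\subset\mathcal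 L_{l+l'}\mathcal{EZ}^A$. -/

import Mathlib

open UpperHalfPlane Filter Topology
open scoped Manifold

noncomputable section

namespace EllMZV

/-! ### The Kronecker series and the functions `f^(k)` -/

/-- The odd Jacobi theta function
`θ_τ(ξ) = ∑_{n ∈ ℤ} (-1)^n q^{(n+1/2)²/2} e^{2πi(n+1/2)ξ}`, `q = e^{2πiτ}`. -/
def theta (τ : ℍ) (ξ : ℂ) : ℂ :=
  ∑' n : ℤ, (-1 : ℂ) ^ n *
    Complex.exp (2 * Real.pi * Complex.I * (τ : ℂ) * (((n : ℂ) + 1 / 2) ^ 2 / 2)) *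
    Complex.exp (((n : ℂ) + 1 / 2) * (2 * Real.pi * Complex.I * ξ))

/-- The Kronecker series `F_τ(ξ, α) = θ'(0) θ(ξ + α) / (θ(ξ) θ(α))`. -/
def kronecker (τ : ℍ) (ξ α : ℂ) : ℂ :=
  deriv (theta τ) 0 * theta τ (ξ + α) / (theta τ ξ * theta τ α)

/-- The function `Ω_τ(ξ, α)` with `Ω_τ(ξ, α) dξ = e^{2πirα} F_τ(ξ, α) dξ`, where `ξ = s + rτ` with
`r`, `s` real, that is `r = Im ξ / Im τ`. -/
def Omega (τ : ℍ) (ξ α : ℂ) : ℂ :=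
  Complex.exp (2 * Real.pi * Complex.I * ((ξ.im / τ.im : ℝ) : ℂ) * α) * kronecker τ ξ α

/-- The function `α ↦ α Ω_τ(ξ, α)`, with its removable singularity at `α = 0` filled in. -/
def alphaOmega (τ : ℍ) (ξ : ℂ) : ℂ → ℂ :=
  Function.update (fun α => α * Omega τ ξ α) 0
    (limUnder (𝓝[≠] (0 : ℂ)) fun α => α * Omega τ ξ α)

/-- The coefficients `f^(k)(ξ)` of the expansion `Ω_τ(ξ, α) = ∑_{k ≥ 0} f^(k)(ξ) α^{k-1}` at
`α = 0`: the Taylor coefficients of `α Ω_τ(ξ, α)`. The one-forms are `ω^(k) = f^(k)(ξ) dξ`. -/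
def f (τ : ℍ) (k : ℕ) (ξ : ℂ) : ℂ :=
  iteratedDeriv k (alphaOmega τ ξ) 0 / (k.factorial : ℂ)

/-! ### Formal power series in two non-commuting variables -/

/-- The two letters. -/
inductive Letter
  | x
  | y

/-- The space `ℂ⟪x, y⟫`: a series is given by its coefficients at the words in `x`, `y`. The
multiplication is `NC.mul`, not the pointwise one. -/
abbrev NC : Type := List Letter → ℂ

/-- The series `1`. -/
def NC.one : NC
  | [] => 1
  | _ => 0

/-- The series `x`. -/
def NC.x : NC
  | [Letter.x] => 1
  | _ => 0

/-- The series `y`. -/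
def NC.y : NC
  | [Letter.y] => 1
  | _ => 0

/-- The (concatenation) product of `ℂ⟪x, y⟫`: `(S T)_w = ∑_{w = uv} S_u T_v`. -/
def NC.mul (S T : NC) : NC := fun w =>
  ∑ i ∈ Finset.range (w.length + 1), S (w.take i) * T (w.drop i)

/-- Powers in `ℂ⟪x, y⟫`. -/
def NC.pow (S : NC) : ℕ → NC
  | 0 => NC.one
  | n + 1 => NC.mul (NC.pow S n) S

/-- The exponential `∑_{n ≥ 0} Sⁿ / n!` of a series `S` without constant term; then `Sⁿ` has no
words of length less than `n`, so that only the terms with `n ≤ |w|` contribute to the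
coefficient of the word `w`. -/
def NC.exp (S : NC) : NC := fun w =>
  ∑ n ∈ Finset.range (w.length + 1), NC.pow S n w / (n.factorial : ℂ)

/-- `ad^n(x)(y)`, where `ad(x)(u) = x u - u x`. -/
def adPow : ℕ → NC
  | 0 => NC.y
  | n + 1 => fun w => NC.mul NC.x (adPow n) w - NC.mul (adPow n) NC.x w

/-- The product `ad^{n₁}(x)(y) ⋯ ad^{n_r}(x)(y)`. -/
def adMonomial : List ℕ → NC
  | [] => NC.one
  | n :: ns => NC.mul (adPow n) (adMonomial ns)

/-- `S = ∑ c(n₁,…,n_r) ad^{n₁}(x)(y) ⋯ ad^{n_r}(x)(y)`, the sum being over all `r ≥ 0` and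
`n₁,…,n_r ≥ 0`. The series `ad^{n₁}(x)(y) ⋯ ad^{n_r}(x)(y)` is homogeneous of degree
`n₁ + ⋯ + n_r + r`, so the sum at each word is a finite one. -/
def HasAdExpansion (S : NC) (c : List ℕ → ℂ) : Prop :=
  ∀ w : List Letter, S w = ∑ᶠ ns : List ℕ, c ns * adMonomial ns w

open Classical in
/-- The coefficients of a series with respect to the products
`ad^{n₁}(x)(y) ⋯ ad^{n_r}(x)(y)`; zero if there is no such expansion. -/
def adCoeff (S : NC) : List ℕ → ℂ :=
  if h : ∃ c, HasAdExpansion S c then h.choose else 0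

/-! ### The regularized generating series -/

/-- The series `ad(x) Ω_τ(ξ, ad(x)) (y) = ∑_{k ≥ 0} f^(k)(ξ) ad^k(x)(y)` (without `dξ`). As
`ad^k(x)(y)` is homogeneous of degree `k + 1`, only `k < |w|` contributes at the word `w`. -/
def connection (τ : ℍ) (ξ : ℂ) : NC := fun w =>
  ∑ k ∈ Finset.range w.length, f τ k ξ * adPow k w

/-- The iterated integral `∫ J ⋯ J` (`k` factors) of `J = ad(x) Ω_τ(ξ, ad(x)) (y) dξ` along the
real segment from `a` to `b`: the integral of `J(t₁) ⋯ J(t_k)` over `a < t₁ < ⋯ < t_k < b`. -/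
def iterInt (τ : ℍ) (a : ℝ) : ℕ → ℝ → NC
  | 0, _ => NC.one
  | k + 1, b => fun w => ∫ s in a..b, NC.mul (iterInt τ a k s) (connection τ (s : ℂ)) w

/-- `exp[∫_a^b J] = 1 + ∑_{k ≥ 1} ∫ J ⋯ J`; as `J` has no constant term, only `k ≤ |w|`
contributes at the word `w`. -/
def pathExp (τ : ℍ) (a b : ℝ) : NC := fun w =>
  ∑ k ∈ Finset.range (w.length + 1), iterInt τ a k b w

/-- `(-2πit)^{ε ad(x)(y)} = exp(ε log(-2πit) ad(x)(y))`, with the principal branch of `log`. -/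
def tPow (t : ℝ) (ε : ℂ) : NC :=
  NC.exp fun w => ε * Complex.log (-2 * Real.pi * Complex.I * (t : ℂ)) * adPow 1 w

/-- `(-2πit)^{ad(x)(y)} exp[∫_t^{1-t} J] (-2πit)^{-ad(x)(y)}`. -/
def preSeries (τ : ℍ) (t : ℝ) : NC :=
  NC.mul (NC.mul (tPow t 1) (pathExp τ t (1 - t))) (tPow t (-1))

/-- The regularized generating series: the coefficientwise limit as `t → 0`, `t > 0`. -/
def regSeries (τ : ℍ) : NC := fun w =>
  limUnder (𝓝[>] (0 : ℝ)) fun t => preSeries τ t w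

/-- The A-elliptic multiple zeta value `I^A(n₁,…,n_r; τ)`, as a function of `τ`: the coefficient
of `ad^{n₁}(x)(y) ⋯ ad^{n_r}(x)(y)` in the regularized generating series. Its length is `r`, its
weight is `n₁ + ⋯ + n_r`. -/
def IA (ns : List ℕ) : ℍ → ℂ := fun τ => adCoeff (regSeries τ) ns

/-! ### The spaces of A-elliptic multiple zeta values -/

/-- `O(ℍ)`, the algebra of holomorphic functions on the upper half-plane. -/
def holo : Subalgebra ℂ (ℍ → ℂ) where
  carrier := {g | MDifferentiable 𝓘(ℂ) 𝓘(ℂ) g}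
  mul_mem' := by
    intro a b ha hb
    exact UpperHalfPlane.mdifferentiable_iff.mpr
      ((UpperHalfPlane.mdifferentiable_iff.mp ha).mul (UpperHalfPlane.mdifferentiable_iff.mp hb))
  add_mem' := by
    intro a b ha hb
    exact UpperHalfPlane.mdifferentiable_iff.mpr
      ((UpperHalfPlane.mdifferentiable_iff.mp ha).add (UpperHalfPlane.mdifferentiable_iff.mp hb))
  algebraMap_mem' := fun _ => mdifferentiable_const

/-- `EZ^A`, the `ℚ`-span of all A-elliptic multiple zeta values. -/
def EZ : Submodule ℚ (ℍ → ℂ) := Submodule.span ℚ (Set.range IA)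

/-- `EZ^A_N`, the `ℚ`-span of the A-elliptic multiple zeta values of weight `N`. -/
def EZw (N : ℕ) : Submodule ℚ (ℍ → ℂ) := Submodule.span ℚ (IA '' {ns | ns.sum = N})

/-- `L_l EZ^A_N`: weight `N` and length at most `l`. -/
def LEZw (l N : ℕ) : Submodule ℚ (ℍ → ℂ) :=
  Submodule.span ℚ (IA '' {ns | ns.sum = N ∧ ns.length ≤ l})

/-- `L_l EZ^A`: length at most `l`. -/
def LEZ (l : ℕ) : Submodule ℚ (ℍ → ℂ) := Submodule.span ℚ (IA '' {ns | ns.length ≤ l})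

/-- The list (with repetitions) of all shuffles of two words. -/
def shuffle : List ℕ → List ℕ → List (List ℕ)
  | [], v => [v]
  | u, [] => [u]
  | a :: u, b :: v =>
    (shuffle u (b :: v)).map (fun w => a :: w) ++ (shuffle (a :: u) v).map (fun w => b :: w)
termination_by u v => u.length + v.length

end EllMZV

end

noncomputable section

namespace EllMZV

/-! ### The theta function -/

/-! Substituting `ad^n(x)(y)` for a free letter `n` gives an injective algebra homomorphism `phi`
from series in the letters `0, 1, 2, …` to series in `x, y` (`phi_mul`, `phi_injective`). The
connection, the iterated integrals and the powers of `-2πit` are all images under `phi`. Hence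
existence and uniqueness of the expansion, the limit and the shuffle formula reduce to series in the
letters `n`, where the shuffle formula says that the coefficients form a character of the shuffle
algebra (`IsChar`).

Convergence rests on a differential equation. Among the `f^(k)` only `f^(1)` is unbounded at the
ends of the segment: it behaves like `1/s` at `0` and, by the reflection `ξ ↦ 1 - ξ`, like
`-1/(1-s)` at `1`. The conjugated series `X(t)` solves `X' = ΛX + XP` (`hasD_preSer`), where `Λ` and
`P` are conjugates by `(-2πit)^{ad(x)(y)}` of the connection at the two ends with these poles
removed; so their coefficients grow at most like powers of `log t`. Since `Λ` and `P` have no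
constant term, the derivative of `X` at a word involves `X` at shorter words only. By induction on
the length every coefficient is an integral over `[t, 1/2]` of a function growing more slowly than
any negative power of the variable (`moderate_preSer`). The limit at `t = 0` therefore exists, and
domination locally uniform in `τ` makes it holomorphic.

The analytic input on `f^(k)` comes from Cauchy's formula in `α` and from the fact that `θ_τ`
vanishes only at the integers in the strip `|Im ξ| < Im τ`. The latter is read off from the Jacobi
triple product, obtained from its finite form by dominated convergence (`tendsto_tripleProduct`,
`exists_le_norm_thetaC`).

Solutions of a linear differential equation with grouplike initial value are grouplike
(`isChar_of_hasDerivAt`). This covers iterated integrals and exponentials, and the property survives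
products and limits. The algebra and filtration statements follow formally, because shuffles add
weights and lengths and the value at the empty sequence is `1`. -/

/-- The terms of the theta series. -/
def thetaTerm (τ ξ : ℂ) (n : ℤ) : ℂ :=
  (-1 : ℂ) ^ n * Complex.exp (2 * Real.pi * Complex.I * τ * (((n : ℂ) + 1 / 2) ^ 2 / 2)) *
    Complex.exp (((n : ℂ) + 1 / 2) * (2 * Real.pi * Complex.I * ξ))

/-- The theta function with `τ` an arbitrary complex number. -/
def thetaC (τ ξ : ℂ) : ℂ := ∑' n : ℤ, thetaTerm τ ξ n

theorem theta_eq_thetaC (τ : ℍ) : theta τ = thetaC τ := rfl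

theorem thetaTerm_eq (τ ξ : ℂ) (n : ℤ) : thetaTerm τ ξ n =
    Complex.exp (Real.pi * Complex.I * (τ / 4 + ξ)) *
      jacobiTheta₂_term n (ξ + τ / 2 + 1 / 2) τ := by
  have h : (-1 : ℂ) ^ n = Complex.exp (n * (Real.pi * Complex.I)) := by
    rw [Complex.exp_int_mul, Complex.exp_pi_mul_I]
  rw [thetaTerm, jacobiTheta₂_term, h, ← Complex.exp_add, ← Complex.exp_add, ← Complex.exp_add]
  congr 1
  ring

/-- Translating by the half period `(τ + 1)/2` and completing the square turns the odd theta
function into `jacobiTheta₂`, which supplies summability and joint holomorphy in `(τ, ξ)`. -/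
theorem thetaC_eq (τ ξ : ℂ) : thetaC τ ξ = Complex.exp (Real.pi * Complex.I * (τ / 4 + ξ)) *
    jacobiTheta₂ (ξ + τ / 2 + 1 / 2) τ := by
  simp only [thetaC, thetaTerm_eq, tsum_mul_left, jacobiTheta₂]

theorem hasSum_thetaTerm {τ : ℂ} (hτ : 0 < τ.im) (ξ : ℂ) :
    HasSum (thetaTerm τ ξ) (thetaC τ ξ) := by
  rw [thetaC_eq]
  simp only [funext (thetaTerm_eq τ ξ)]
  exact (hasSum_jacobiTheta₂_term _ hτ).mul_left _

theorem differentiableAt_thetaC {τ : ℂ} (hτ : 0 < τ.im) (ξ : ℂ) :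
    DifferentiableAt ℂ (fun p : ℂ × ℂ => thetaC p.1 p.2) (τ, ξ) := by
  simp only [thetaC_eq]
  have h1 : DifferentiableAt ℂ (fun p : ℂ × ℂ => jacobiTheta₂ p.1 p.2)
      ((fun p : ℂ × ℂ => (p.2 + p.1 / 2 + 1 / 2, p.1)) (τ, ξ)) :=
    (hasFDerivAt_jacobiTheta₂ (ξ + τ / 2 + 1 / 2) hτ).differentiableAt
  have h2 := h1.comp (τ, ξ) (f := fun p : ℂ × ℂ => (p.2 + p.1 / 2 + 1 / 2, p.1)) (by fun_prop)
  exact DifferentiableAt.mul (by fun_prop) h2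

theorem differentiable_thetaC {τ : ℂ} (hτ : 0 < τ.im) : Differentiable ℂ (thetaC τ) := fun ξ =>
  (differentiableAt_thetaC hτ ξ).comp ξ (f := fun x => (τ, x)) (by fun_prop)

theorem thetaC_neg (τ ξ : ℂ) : thetaC τ (-ξ) = -thetaC τ ξ := by
  rw [thetaC, thetaC, ← tsum_neg, ← (Equiv.subLeft (-1 : ℤ)).tsum_eq]
  refine tsum_congr fun n => ?_
  have h : (-1 : ℂ) ^ (-1 - n) = -(-1) ^ n := by
    rw [zpow_sub₀ (by norm_num)]
    rcases n.even_or_odd with h | h <;> simp [h.neg_one_zpow]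
  have h1 : ((((-1 - n : ℤ) : ℂ) + 1 / 2) ^ 2 / 2) = (((n : ℂ) + 1 / 2) ^ 2 / 2) := by
    push_cast; ring
  have h2 : (((-1 - n : ℤ) : ℂ) + 1 / 2) * (2 * Real.pi * Complex.I * -ξ) =
      ((n : ℂ) + 1 / 2) * (2 * Real.pi * Complex.I * ξ) := by
    push_cast; ring
  simp only [Equiv.subLeft_apply, thetaTerm, h, h1, h2, neg_mul]

theorem thetaC_add_one (τ ξ : ℂ) : thetaC τ (ξ + 1) = -thetaC τ ξ := by
  rw [thetaC_eq, thetaC_eq, show ξ + 1 + τ / 2 + 1 / 2 = (ξ + τ / 2 + 1 / 2) + 1 by ring,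
    jacobiTheta₂_add_left, show Real.pi * Complex.I * (τ / 4 + (ξ + 1)) =
      Real.pi * Complex.I * (τ / 4 + ξ) + Real.pi * Complex.I by ring, Complex.exp_add,
    Complex.exp_pi_mul_I]
  ring

theorem thetaC_zero (τ : ℂ) : thetaC τ 0 = 0 := by
  have := thetaC_neg τ 0
  rw [neg_zero] at this
  linear_combination this / 2

/-- This recursion is all that the triple product uses about the terms of the series. -/
theorem thetaTerm_succ (τ ξ : ℂ) (n : ℤ) : thetaTerm τ ξ (n + 1) =
    -(Complex.exp (2 * Real.pi * Complex.I * τ) ^ (n + 1) * Complex.exp (2 * Real.pi * Complex.I * ξ)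
      * thetaTerm τ ξ n) := by
  rw [thetaTerm, thetaTerm, zpow_add_one₀ (by norm_num), ← Complex.exp_int_mul]
  have : Complex.exp (2 * Real.pi * Complex.I * τ * ((((n + 1 : ℤ) : ℂ) + 1 / 2) ^ 2 / 2)) *
      Complex.exp ((((n + 1 : ℤ) : ℂ) + 1 / 2) * (2 * Real.pi * Complex.I * ξ)) =
      Complex.exp (((n + 1 : ℤ) : ℂ) * (2 * Real.pi * Complex.I * τ)) *
      Complex.exp (2 * Real.pi * Complex.I * ξ) *
      (Complex.exp (2 * Real.pi * Complex.I * τ * (((n : ℂ) + 1 / 2) ^ 2 / 2)) *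
      Complex.exp (((n : ℂ) + 1 / 2) * (2 * Real.pi * Complex.I * ξ))) := by
    simp only [← Complex.exp_add]
    congr 1
    push_cast
    ring
  linear_combination (-1 : ℂ) ^ n * (-1) * this

/-! ### The finite Jacobi triple product -/

/-- `(q)_n = ∏_{j=1}^n (1 - q^j)`. -/
def qFact (q : ℂ) (n : ℕ) : ℂ := ∏ j ∈ Finset.range n, (1 - q ^ (j + 1))

/-- `1 / (q)_n`, extended by zero to negative `n`. -/
def qFactInv (q : ℂ) : ℤ → ℂ
  | Int.ofNat n => (qFact q n)⁻¹
  | Int.negSucc _ => 0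

theorem qFactInv_zero (q : ℂ) : qFactInv q 0 = 1 := by
  change (qFact q 0)⁻¹ = 1
  simp [qFact]

theorem one_sub_pow_ne_zero {q : ℂ} (hq : ‖q‖ < 1) (n : ℕ) : 1 - q ^ (n + 1) ≠ 0 := by
  intro h
  have h1 : ‖q ^ (n + 1)‖ = 1 := by rw [← sub_eq_zero.1 h, norm_one]
  rw [norm_pow] at h1
  exact absurd h1 (pow_lt_one₀ (norm_nonneg q) hq (by omega)).ne

/-- Valid for every integer: at `n = 0` the factor `1 - q^0` vanishes, in agreement with `1/(q)_{-1}
= 0`. The recursion for the `q`-binomial coefficients thus needs no boundary cases. -/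
theorem qFactInv_sub_one {q : ℂ} (hq : ‖q‖ < 1) (n : ℤ) :
    qFactInv q (n - 1) = (1 - q ^ n) * qFactInv q n := by
  obtain ⟨m, rfl | rfl⟩ := n.eq_nat_or_neg
  · cases m with
    | zero =>
      have h0 : qFactInv q (-1) = 0 := rfl
      simp [h0]
    | succ m =>
      have h1 : ((m + 1 : ℕ) : ℤ) - 1 = Int.ofNat m := by simp
      have h2 : ((m + 1 : ℕ) : ℤ) = Int.ofNat (m + 1) := rfl
      rw [h1, h2]
      simp only [qFactInv, qFact, Finset.prod_range_succ, Int.ofNat_eq_natCast, zpow_natCast]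
      rw [mul_inv, mul_left_comm, mul_inv_cancel₀ (one_sub_pow_ne_zero hq m), mul_one]
  · cases m with
    | zero =>
      have h0 : qFactInv q (-1) = 0 := rfl
      simp [h0]
    | succ m =>
      have h1 : -((m + 1 : ℕ) : ℤ) - 1 = Int.negSucc (m + 1) := by
        rw [Int.negSucc_eq]; push_cast; ring
      have h2 : -((m + 1 : ℕ) : ℤ) = Int.negSucc m := rfl
      rw [h1, h2]
      simp [qFactInv]

/-- The coefficients of the finite triple product. -/
def tripleCoeff (q : ℂ) (N : ℕ) (n : ℤ) : ℂ :=
  qFact q (2 * N) * qFactInv q (N + n) * qFactInv q (N - n)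

/-- `tripleCoeff q N n` is the `q`-binomial coefficient `2N` over `N + n`; this is the `q`-Pascal
rule applied twice. -/
theorem tripleCoeff_succ {q : ℂ} (hq : ‖q‖ < 1) (hq0 : q ≠ 0) (N : ℕ) (n : ℤ) :
    tripleCoeff q (N + 1) n = (1 + q ^ (2 * N + 1)) * tripleCoeff q N n +
      q ^ ((N : ℤ) + 1 - n) * tripleCoeff q N (n - 1) +
      q ^ ((N : ℤ) + 1 + n) * tripleCoeff q N (n + 1) := by
  have e1 := qFactInv_sub_one hq ((N : ℤ) + 1 + n)
  have e2 := qFactInv_sub_one hq ((N : ℤ) + 1 - n)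
  have e3 := qFactInv_sub_one hq ((N : ℤ) + n)
  have e4 := qFactInv_sub_one hq ((N : ℤ) - n)
  have p1 : q ^ ((N : ℤ) + n) = q ^ ((N : ℤ) + 1 + n) / q := by
    rw [div_eq_mul_inv, ← zpow_sub_one₀ hq0]; congr 1; ring
  have p2 : q ^ ((N : ℤ) - n) = q ^ ((N : ℤ) + 1 - n) / q := by
    rw [div_eq_mul_inv, ← zpow_sub_one₀ hq0]; congr 1; ring
  have p3 : q ^ (2 * N + 1) = q ^ ((N : ℤ) + 1 + n) * q ^ ((N : ℤ) + 1 - n) / q := by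
    rw [← zpow_add₀ hq0, div_eq_mul_inv, ← zpow_sub_one₀ hq0, ← zpow_natCast]; congr 1; push_cast; ring
  have p4 : qFact q (2 * (N + 1)) = qFact q (2 * N) * (1 - q ^ (2 * N + 1)) *
      (1 - q ^ (2 * N + 1) * q) := by
    rw [show 2 * (N + 1) = 2 * N + 1 + 1 by ring, qFact, Finset.prod_range_succ,
      Finset.prod_range_succ, qFact, pow_succ q (2 * N + 1)]
  rw [show (N : ℤ) + 1 + n - 1 = N + n by ring] at e1
  rw [show (N : ℤ) + 1 - n - 1 = N - n by ring] at e2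
  simp only [tripleCoeff]
  rw [show (N : ℤ) + (n - 1) = N + n - 1 by ring, show (N : ℤ) - (n - 1) = N + 1 - n by ring,
    show (N : ℤ) + (n + 1) = N + 1 + n by ring, show (N : ℤ) - (n + 1) = N - n - 1 by ring,
    e3, e4, e1, e2, p1, p2, p4, p3]
  push_cast
  field_simp
  ring

/-- The finite Jacobi triple product. -/
theorem hasSum_tripleCoeff {q w : ℂ} (hq : ‖q‖ < 1) (hq0 : q ≠ 0) (hw : w ≠ 0) {v : ℤ → ℂ}
    (hv : ∀ n, v (n + 1) = -(q ^ (n + 1) * w * v n)) (N : ℕ) :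
    HasSum (fun n => v n * tripleCoeff q N n)
      (v 0 * ∏ j ∈ Finset.range N, ((1 - q ^ (j + 1) * w) * (1 - q ^ j / w))) := by
  induction N with
  | zero =>
    have h0 : v 0 * ∏ j ∈ Finset.range 0, ((1 - q ^ (j + 1) * w) * (1 - q ^ j / w)) =
        v 0 * tripleCoeff q 0 0 := by
      simp [tripleCoeff, qFact, qFactInv_zero]
    rw [h0]
    refine hasSum_single 0 fun n hn => ?_
    rcases lt_or_gt_of_ne hn with h | h
    · obtain ⟨m, rfl⟩ := Int.eq_negSucc_of_lt_zero h
      simp [tripleCoeff, qFactInv]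
    · have h' : -n < 0 := by omega
      obtain ⟨m, hm⟩ := Int.eq_negSucc_of_lt_zero h'
      simp [tripleCoeff, qFactInv, hm]
  | succ N ih =>
    have h1 := ih.mul_left (1 + q ^ (2 * N + 1))
    -- The new factor is `1 + q^(2N+1) - q^(N+1) w - q^N / w`. The recursion for `v` absorbs `w` and
    -- `1/w` into shifts of the summation index by one.
    have h2 := (Equiv.addRight (-1 : ℤ)).hasSum_iff.2 (ih.mul_left (-(q ^ (N + 1) * w)))
    have h3 := (Equiv.addRight (1 : ℤ)).hasSum_iff.2 (ih.mul_left (-(q ^ N / w)))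
    have h4 := (h1.add h2).add h3
    have e : v 0 * ∏ j ∈ Finset.range (N + 1), ((1 - q ^ (j + 1) * w) * (1 - q ^ j / w)) =
        (1 + q ^ (2 * N + 1)) *
          (v 0 * ∏ j ∈ Finset.range N, ((1 - q ^ (j + 1) * w) * (1 - q ^ j / w))) +
        -(q ^ (N + 1) * w) *
          (v 0 * ∏ j ∈ Finset.range N, ((1 - q ^ (j + 1) * w) * (1 - q ^ j / w))) +
        -(q ^ N / w) *
          (v 0 * ∏ j ∈ Finset.range N, ((1 - q ^ (j + 1) * w) * (1 - q ^ j / w))) := by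
      rw [Finset.prod_range_succ]
      field_simp
      ring_nf
    rw [e]
    refine h4.congr_fun fun n => ?_
    · have hv1 := hv (n - 1)
      rw [sub_add_cancel] at hv1
      have z1 : q ^ ((N : ℤ) + 1 - n) * q ^ n = q ^ (N + 1) := by
        rw [← zpow_add₀ hq0, ← zpow_natCast]; congr 1; push_cast; ring
      have z2 : q ^ ((N : ℤ) + 1 + n) = q ^ N * q ^ (n + 1) := by
        rw [← zpow_natCast, ← zpow_add₀ hq0]; congr 1; ring
      simp only [Function.comp, Equiv.coe_addRight, ← sub_eq_add_neg]
      rw [tripleCoeff_succ hq hq0, ← z1, z2, hv n, hv1]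
      field_simp
      ring

theorem multipliable_qFact {q : ℂ} (hq : ‖q‖ < 1) : Multipliable fun j : ℕ => 1 - q ^ (j + 1) := by
  simp only [sub_eq_add_neg]
  refine multipliable_one_add_of_summable ?_
  simp only [norm_neg, norm_pow]
  exact (summable_nat_add_iff 1).2 (summable_geometric_of_lt_one (norm_nonneg q) hq)

theorem tprod_qFact_ne_zero {q : ℂ} (hq : ‖q‖ < 1) : ∏' j : ℕ, (1 - q ^ (j + 1)) ≠ 0 := by
  simp only [sub_eq_add_neg]
  refine tprod_one_add_ne_zero_of_summable (fun j => ?_) ?_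
  · simpa [sub_eq_add_neg] using one_sub_pow_ne_zero hq j
  · simp only [norm_neg, norm_pow]
    exact (summable_nat_add_iff 1).2 (summable_geometric_of_lt_one (norm_nonneg q) hq)

theorem tendsto_qFact {q : ℂ} (hq : ‖q‖ < 1) :
    Tendsto (qFact q) atTop (𝓝 (∏' j : ℕ, (1 - q ^ (j + 1)))) :=
  (multipliable_qFact hq).tendsto_prod_tprod_nat

theorem tendsto_qFactInv {q : ℂ} (hq : ‖q‖ < 1) :
    Tendsto (qFactInv q) atTop (𝓝 (∏' j : ℕ, (1 - q ^ (j + 1)))⁻¹) := by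
  have h := ((tendsto_qFact hq).inv₀ (tprod_qFact_ne_zero hq)).comp
    (tendsto_atTop_atTop.2 fun b => ⟨(b : ℤ), fun a ha => by omega⟩ : Tendsto Int.toNat atTop atTop)
  refine h.congr' ?_
  filter_upwards [eventually_ge_atTop 0] with n hn
  obtain ⟨m, rfl⟩ := Int.eq_ofNat_of_zero_le hn
  rfl

/-- The partial products `(q)_n` converge to a nonzero limit, so they and their inverses are
bounded. Uniformity in `N` and `n` provides the dominating series in `tendsto_tripleProduct`. -/
theorem exists_norm_tripleCoeff_le {q : ℂ} (hq : ‖q‖ < 1) :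
    ∃ C, ∀ N n, ‖tripleCoeff q N n‖ ≤ C := by
  obtain ⟨A, hA⟩ := (tendsto_qFact hq).norm.bddAbove_range
  obtain ⟨B, hB⟩ := ((tendsto_qFact hq).inv₀ (tprod_qFact_ne_zero hq)).norm.bddAbove_range
  have hA' : ∀ n, ‖qFact q n‖ ≤ A := fun n => hA ⟨n, rfl⟩
  have hB0 : 0 ≤ B := (norm_nonneg _).trans (hB ⟨0, rfl⟩)
  have hB' : ∀ n, ‖qFactInv q n‖ ≤ B := by
    rintro (n | n)
    · exact hB ⟨n, rfl⟩
    · simpa [qFactInv] using hB0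
  refine ⟨A * B * B, fun N n => ?_⟩
  rw [tripleCoeff, norm_mul, norm_mul]
  have := (norm_nonneg _).trans (hA' 0)
  gcongr <;> solve_by_elim

theorem tendsto_tripleCoeff {q : ℂ} (hq : ‖q‖ < 1) (n : ℤ) :
    Tendsto (fun N => tripleCoeff q N n) atTop (𝓝 (∏' j : ℕ, (1 - q ^ (j + 1)))⁻¹) := by
  have h1 := (tendsto_qFact hq).comp (tendsto_id.const_mul_atTop' (by norm_num : 0 < 2))
  have h2 := (tendsto_qFactInv hq).comp
    (tendsto_atTop_add_const_right atTop n tendsto_natCast_atTop_atTop)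
  have h3 := (tendsto_qFactInv hq).comp
    (tendsto_atTop_add_const_right atTop (-n) tendsto_natCast_atTop_atTop)
  have := (h1.mul h2).mul h3
  rw [mul_inv_cancel₀ (tprod_qFact_ne_zero hq), one_mul] at this
  exact this

/-- The Jacobi triple product, as a limit. -/
theorem tendsto_tripleProduct {τ : ℂ} (hτ : 0 < τ.im) (ξ : ℂ) :
    Tendsto (fun N => thetaTerm τ ξ 0 * ∏ j ∈ Finset.range N,
      ((1 - Complex.exp (2 * Real.pi * Complex.I * τ) ^ (j + 1) *
          Complex.exp (2 * Real.pi * Complex.I * ξ)) *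
        (1 - Complex.exp (2 * Real.pi * Complex.I * τ) ^ j /
          Complex.exp (2 * Real.pi * Complex.I * ξ)))) atTop
      (𝓝 (thetaC τ ξ *
        (∏' j : ℕ, (1 - Complex.exp (2 * Real.pi * Complex.I * τ) ^ (j + 1)))⁻¹)) := by
  have hq : ‖Complex.exp (2 * Real.pi * Complex.I * τ)‖ < 1 := by
    simpa using UpperHalfPlane.norm_exp_two_pi_I_lt_one ⟨τ, hτ⟩
  obtain ⟨C, hC⟩ := exists_norm_tripleCoeff_le hq
  have hs := hasSum_thetaTerm hτ ξ
  have key := tendsto_tsum_of_dominated_convergence (𝓕 := atTop)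
    (f := fun (N : ℕ) n => thetaTerm τ ξ n *
      tripleCoeff (Complex.exp (2 * Real.pi * Complex.I * τ)) N n)
    (g := fun n => thetaTerm τ ξ n *
      (∏' j : ℕ, (1 - Complex.exp (2 * Real.pi * Complex.I * τ) ^ (j + 1)))⁻¹)
    (bound := fun n => ‖thetaTerm τ ξ n‖ * C) (hs.summable.norm.mul_right C)
    (fun n => (tendsto_tripleCoeff hq n).const_mul _)
    (Eventually.of_forall fun N n => by
      rw [norm_mul]; exact mul_le_mul_of_nonneg_left (hC N n) (norm_nonneg _))
  rw [tsum_mul_right] at key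
  refine key.congr fun N => ?_
  exact (hasSum_tripleCoeff hq (Complex.exp_ne_zero _) (Complex.exp_ne_zero _)
    (thetaTerm_succ τ ξ) N).tsum_eq

end EllMZV

namespace EllMZV

/-! ### Integrals depending holomorphically on a parameter -/

open MeasureTheory in
/-- A locally dominated integral of holomorphic functions is holomorphic. -/
theorem differentiableOn_integral {X : Type*} [MeasurableSpace X] {μ : Measure X}
    {U : Set ℂ} (hU : IsOpen U) {G : ℂ → X → ℂ}
    (hmeas : ∀ z ∈ U, AEStronglyMeasurable (G z) μ)
    (hdiff : ∀ᵐ x ∂μ, DifferentiableOn ℂ (fun z => G z x) U)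
    (hdom : ∀ z₀ ∈ U, ∃ V ∈ 𝓝 z₀, ∃ bound : X → ℝ, Integrable bound μ ∧
      ∀ᵐ x ∂μ, ∀ z ∈ V, ‖G z x‖ ≤ bound x) :
    DifferentiableOn ℂ (fun z => ∫ x, G z x ∂μ) U := by
  intro z₀ hz₀
  obtain ⟨V, hV, bound, hb, hle⟩ := hdom z₀ hz₀
  obtain ⟨R, hR, hsub⟩ := Metric.mem_nhds_iff.1 (inter_mem hV (hU.mem_nhds hz₀))
  have hUb : ∀ z ∈ Metric.ball z₀ R, z ∈ U := fun z hz => (hsub hz).2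
  have hVb : ∀ z ∈ Metric.ball z₀ R, z ∈ V := fun z hz => (hsub hz).1
  have hmem : Metric.ball z₀ (R / 2) ∈ 𝓝 z₀ := Metric.ball_mem_nhds _ (by positivity)
  have hball : ∀ z ∈ Metric.ball z₀ (R / 2), Metric.closedBall z (R / 4) ⊆ Metric.ball z₀ R := by
    intro z hz w hw
    rw [Metric.mem_ball] at *
    rw [Metric.mem_closedBall] at hw
    linarith [dist_triangle w z z₀]
  have hd : ∀ᵐ x ∂μ, ∀ z ∈ Metric.ball z₀ (R / 2),
      HasDerivAt (fun z => G z x) (deriv (fun z => G z x) z) z := by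
    filter_upwards [hdiff] with x hx z hz
    exact (hx.differentiableAt (hU.mem_nhds (hUb z (hball z hz
      (Metric.mem_closedBall_self (by positivity)))))).hasDerivAt
  have hz₀R : z₀ ∈ Metric.ball z₀ (R / 2) := Metric.mem_ball_self (by positivity)
  -- Discs of radius `R / 4` around points of the ball of radius `R / 2` stay in the ball of radius
  -- `R`, so Cauchy's estimate dominates the derivative by `bound / (R / 4)`. Measurability of the
  -- derivative comes from a sequence of difference quotients.
  have key := hasDerivAt_integral_of_dominated_loc_of_deriv_le (μ := μ) (F := G) (x₀ := z₀)
    (F' := fun z x => deriv (fun z => G z x) z) (bound := fun x => bound x / (R / 4)) hmem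
    (eventually_of_mem hmem fun z hz => hmeas z (hUb z (hball z hz
      (Metric.mem_closedBall_self (by positivity)))))
    (hb.mono' (hmeas z₀ hz₀) (by
      filter_upwards [hle] with x hx using hx z₀ (mem_of_mem_nhds hV)))
    ?_ ?_ (hb.div_const _) hd
  · exact key.2.differentiableAt.differentiableWithinAt
  · -- difference quotients
    obtain ⟨u, hu⟩ : ∃ u : ℕ → ℂ, (∀ n, u n ≠ 0 ∧ z₀ + u n ∈ U) ∧ Tendsto u atTop (𝓝[≠] 0) := by
      refine ⟨fun n => ((R / 2 / (n + 1) : ℝ) : ℂ), fun n => ⟨?_, hUb _ ?_⟩, ?_⟩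
      · exact Complex.ofReal_ne_zero.2 (by positivity)
      · rw [Metric.mem_ball, dist_eq_norm, add_sub_cancel_left, Complex.norm_real,
          Real.norm_of_nonneg (by positivity)]
        calc R / 2 / (n + 1) ≤ R / 2 / 1 := by gcongr; linarith [n.cast_nonneg (α := ℝ)]
          _ < R := by linarith
      · refine tendsto_nhdsWithin_iff.2 ⟨?_, Eventually.of_forall fun n => ?_⟩
        · have h1 : Tendsto (fun n : ℕ => R / 2 * (1 / ((n : ℝ) + 1))) atTop (𝓝 (R / 2 * 0)) :=
            tendsto_one_div_add_atTop_nhds_zero_nat.const_mul _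
          rw [mul_zero] at h1
          have h2 := (Complex.continuous_ofReal.tendsto 0).comp h1
          refine (h2.congr fun n => ?_).trans (by simp)
          simp [div_eq_mul_inv]
        · exact Complex.ofReal_ne_zero.2 (by positivity)
    refine aestronglyMeasurable_of_tendsto_ae (u := atTop)
      (f := fun n x => (u n)⁻¹ • (G (z₀ + u n) x - G z₀ x)) (fun n => ?_) ?_
    · exact ((hmeas _ (hu.1 n).2).sub (hmeas _ hz₀)).const_smul (u n)⁻¹
    · filter_upwards [hd] with x hx
      exact (hasDerivAt_iff_tendsto_slope_zero.1 (hx z₀ hz₀R)).comp hu.2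
  · filter_upwards [hle, hdiff] with x hx hdx z hz
    refine Complex.norm_deriv_le_of_forall_mem_sphere_norm_le (by positivity) ?_ fun w hw => ?_
    · exact (hdx.mono fun w hw => hUb w (hball z hz hw)).diffContOnCl_ball subset_rfl
    · exact hx w (hVb w (hball z hz (Metric.sphere_subset_closedBall hw)))

/-- Circle integrals of functions holomorphic in a parameter are holomorphic. -/
theorem differentiableOn_circleIntegral {U : Set ℂ} (hU : IsOpen U) {ρ : ℝ} (hρ : 0 ≤ ρ)
    {K : ℂ → ℂ → ℂ}
    (hcont : ContinuousOn (Function.uncurry K) (U ×ˢ Metric.sphere 0 ρ))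
    (hdiff : ∀ α ∈ Metric.sphere (0 : ℂ) ρ, DifferentiableOn ℂ (fun z => K z α) U) :
    DifferentiableOn ℂ (fun z => ∮ α in C(0, ρ), K z α) U := by
  have hcirc : ∀ t, circleMap 0 ρ t ∈ Metric.sphere (0 : ℂ) ρ := circleMap_mem_sphere 0 hρ
  have hc : ∀ z ∈ U, Continuous fun t => deriv (circleMap 0 ρ) t • K z (circleMap 0 ρ t) := by
    intro z hz
    have h1 : Continuous fun t => K z (circleMap 0 ρ t) :=
      hcont.comp_continuous (f := fun t => (z, circleMap 0 ρ t)) (by fun_prop)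
        fun t => ⟨hz, hcirc t⟩
    simp only [deriv_circleMap]
    exact ((continuous_circleMap 0 ρ).mul continuous_const).smul h1
  simp only [circleIntegral, intervalIntegral.integral_of_le Real.two_pi_pos.le]
  refine differentiableOn_integral hU (fun z hz => (hc z hz).aestronglyMeasurable)
    (Eventually.of_forall fun t => ?_) fun z₀ hz₀ => ?_
  · exact (hdiff _ (hcirc t)).const_smul (deriv (circleMap 0 ρ) t)
  · obtain ⟨R, hR, hsub⟩ := Metric.nhds_basis_closedBall.mem_iff.1 (hU.mem_nhds hz₀)
    obtain ⟨C, hC⟩ := ((isCompact_closedBall z₀ R).prod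
      (isCompact_sphere (0 : ℂ) ρ)).exists_bound_of_continuousOn
      (hcont.mono (Set.prod_mono hsub subset_rfl))
    refine ⟨_, Metric.closedBall_mem_nhds z₀ hR, fun _ => ρ * C, MeasureTheory.integrable_const _,
      Eventually.of_forall fun t z hz => ?_⟩
    rw [norm_smul]
    have := hC (z, circleMap 0 ρ t) ⟨hz, hcirc t⟩
    simp only [deriv_circleMap, norm_mul, Complex.norm_I, norm_circleMap_zero, mul_one,
      abs_of_nonneg hρ]
    exact mul_le_mul_of_nonneg_left this hρ

end EllMZV

namespace EllMZV

/-! ### Zeros of the theta function -/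

theorem norm_exp_two_pi_I_mul (ξ : ℂ) :
    ‖Complex.exp (2 * Real.pi * Complex.I * ξ)‖ = Real.exp (-(2 * Real.pi * ξ.im)) := by
  rw [Complex.norm_exp]
  simp

/-- Write `w = e^{2πiξ}`. In the strip only the factor `1 - 1/w` of the triple product can vanish.
All others have the form `1 - q^(j+1) u` with `|u| ≤ R = e^{2πy}` and `|q| R < 1`, so their products
are bounded below by those of `1 - |q|^(j+1) R`. Uniformity in `ξ` allows division by `ξ` near zero,
hence also a bound for `θ'(0)`. -/
theorem exists_le_norm_thetaC {τ : ℂ} {y : ℝ} (hy0 : 0 ≤ y) (hy : y < τ.im) :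
    ∃ c > 0, ∀ ξ : ℂ, |ξ.im| ≤ y →
      c * ‖Complex.exp (2 * Real.pi * Complex.I * ξ) - 1‖ ≤ ‖thetaC τ ξ‖ := by
  have hτ : 0 < τ.im := hy0.trans_lt hy
  set q := Complex.exp (2 * Real.pi * Complex.I * τ) with hqdef
  set R := Real.exp (2 * Real.pi * y) with hR
  have hnq : ‖q‖ = Real.exp (-(2 * Real.pi * τ.im)) := norm_exp_two_pi_I_mul τ
  have hq : ‖q‖ < 1 := by
    rw [hnq, Real.exp_lt_one_iff]
    have := Real.pi_pos
    simp only [Left.neg_neg_iff]; positivity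
  have hq0 : 0 < ‖q‖ := norm_pos_iff.2 (Complex.exp_ne_zero _)
  have hR1 : 1 ≤ R := Real.one_le_exp (by positivity)
  have hqR : ‖q‖ * R < 1 := by
    rw [hnq, hR, ← Real.exp_add, Real.exp_lt_one_iff]
    nlinarith [Real.pi_pos]
  have hpos : ∀ j : ℕ, 0 < 1 - ‖q‖ ^ (j + 1) * R := by
    intro j
    have : ‖q‖ ^ (j + 1) * R ≤ ‖q‖ * R := by
      gcongr
      exact pow_le_of_le_one hq0.le hq.le (by omega)
    linarith
  have hsum : Summable fun j : ℕ => ‖-(‖q‖ ^ (j + 1) * R)‖ := by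
    simp only [norm_neg, norm_mul, norm_pow, norm_norm]
    exact ((summable_nat_add_iff 1).2 (summable_geometric_of_lt_one hq0.le hq)).mul_right _
  have hne : ∏' j : ℕ, (1 - ‖q‖ ^ (j + 1) * R) ≠ 0 := by
    simp only [sub_eq_add_neg]
    refine tprod_one_add_ne_zero_of_summable (fun j => ?_) hsum
    simpa [sub_eq_add_neg] using (hpos j).ne'
  have hlim : Tendsto (fun N => ∏ j ∈ Finset.range N, (1 - ‖q‖ ^ (j + 1) * R)) atTop
      (𝓝 (∏' j : ℕ, (1 - ‖q‖ ^ (j + 1) * R))) := by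
    refine Multipliable.tendsto_prod_tprod_nat ?_
    simp only [sub_eq_add_neg]
    exact multipliable_one_add_of_summable hsum
  obtain ⟨B, hB⟩ := (hlim.inv₀ hne).bddAbove_range
  have hppos : ∀ N, 0 < ∏ j ∈ Finset.range N, (1 - ‖q‖ ^ (j + 1) * R) :=
    fun N => Finset.prod_pos fun j _ => hpos j
  have hBpos : 0 < B := (inv_pos.2 (hppos 0)).trans_le (hB ⟨0, rfl⟩)
  have hp : ∀ N, B⁻¹ ≤ ∏ j ∈ Finset.range N, (1 - ‖q‖ ^ (j + 1) * R) := fun N =>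
    inv_le_of_inv_le₀ (hppos N) (hB ⟨N, rfl⟩)
  have hfac : ∀ u : ℂ, ‖u‖ ≤ R → ∀ N,
      B⁻¹ ≤ ‖∏ j ∈ Finset.range N, (1 - q ^ (j + 1) * u)‖ := by
    intro u hu N
    rw [norm_prod]
    refine (hp N).trans (Finset.prod_le_prod (fun j _ => (hpos j).le) fun j _ => ?_)
    calc 1 - ‖q‖ ^ (j + 1) * R ≤ ‖(1 : ℂ)‖ - ‖q ^ (j + 1) * u‖ := by
          rw [norm_one, norm_mul, norm_pow]; gcongr
      _ ≤ _ := norm_sub_norm_le _ _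
  set K := ‖(∏' j : ℕ, (1 - q ^ (j + 1)))⁻¹‖ with hK
  have hK0 : 0 < K := norm_pos_iff.2 (inv_ne_zero (tprod_qFact_ne_zero hq))
  set m := Real.exp (-(Real.pi * τ.im / 4) - Real.pi * y) with hm
  have hm0 : 0 < m := Real.exp_pos _
  -- `m` bounds the term with index `0`, each `B⁻¹` one of the two products, and `R⁻¹` the factor
  -- `|1/w|` in `1 - 1/w = (w - 1)/w`. Division by `K` undoes the normalization of the limit in
  -- `tendsto_tripleProduct`.
  refine ⟨m * B⁻¹ * B⁻¹ * R⁻¹ / K, by positivity, fun ξ hξ => ?_⟩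
  set w := Complex.exp (2 * Real.pi * Complex.I * ξ) with hw
  have hw0 : w ≠ 0 := Complex.exp_ne_zero _
  have hwR : ‖w‖ ≤ R := by
    rw [hw, norm_exp_two_pi_I_mul, hR, Real.exp_le_exp]
    nlinarith [Real.pi_pos, neg_abs_le ξ.im]
  have hwR' : ‖w⁻¹‖ ≤ R := by
    rw [norm_inv, hw, norm_exp_two_pi_I_mul, ← Real.exp_neg, hR, Real.exp_le_exp]
    nlinarith [Real.pi_pos, le_abs_self ξ.im]
  have hmv : m ≤ ‖thetaTerm τ ξ 0‖ := by
    rw [thetaTerm, norm_mul, norm_mul, Complex.norm_exp, Complex.norm_exp, zpow_zero, norm_one,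
      one_mul, ← Real.exp_add, hm, Real.exp_le_exp]
    have e1 : (2 * Real.pi * Complex.I * τ * ((((0 : ℤ) : ℂ) + 1 / 2) ^ 2 / 2)).re =
        -(Real.pi * τ.im / 4) := by
      rw [show (2 * Real.pi * Complex.I * τ * ((((0 : ℤ) : ℂ) + 1 / 2) ^ 2 / 2)) =
        ((Real.pi / 4 : ℝ) : ℂ) * (Complex.I * τ) by push_cast; ring, Complex.re_ofReal_mul]
      simp; ring
    have e2 : ((((0 : ℤ) : ℂ) + 1 / 2) * (2 * Real.pi * Complex.I * ξ)).re =
        -(Real.pi * ξ.im) := by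
      rw [show ((((0 : ℤ) : ℂ) + 1 / 2) * (2 * Real.pi * Complex.I * ξ)) =
        (Real.pi : ℂ) * (Complex.I * ξ) by push_cast; ring, Complex.re_ofReal_mul]
      simp
    rw [e1, e2]
    nlinarith [Real.pi_pos, le_abs_self ξ.im]
  have hlow : ∀ N : ℕ, m * B⁻¹ * B⁻¹ * R⁻¹ * ‖w - 1‖ ≤
      ‖thetaTerm τ ξ 0 * ∏ j ∈ Finset.range (N + 1), ((1 - q ^ (j + 1) * w) * (1 - q ^ j / w))‖ := by
    intro N
    have e : ∏ j ∈ Finset.range (N + 1), (1 - q ^ j / w) =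
        (∏ j ∈ Finset.range N, (1 - q ^ (j + 1) * w⁻¹)) * ((w - 1) * w⁻¹) := by
      rw [Finset.prod_range_succ']
      simp only [div_eq_mul_inv, pow_zero, one_mul]
      rw [sub_mul, mul_inv_cancel₀ hw0, one_mul]
    rw [Finset.prod_mul_distrib, e, norm_mul, norm_mul, norm_mul, norm_mul]
    have h1 := hfac w hwR (N + 1)
    have h2 := hfac w⁻¹ hwR' N
    have h3 : R⁻¹ ≤ ‖w⁻¹‖ := by
      rw [norm_inv]
      exact inv_anti₀ (norm_pos_iff.2 hw0) hwR
    have hBi := inv_pos.2 hBpos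
    calc m * B⁻¹ * B⁻¹ * R⁻¹ * ‖w - 1‖ = m * (B⁻¹ * (B⁻¹ * (‖w - 1‖ * R⁻¹))) := by ring
      _ ≤ _ := by gcongr
  have hT := ((tendsto_tripleProduct hτ ξ).comp (tendsto_add_atTop_nat 1)).norm
  have := ge_of_tendsto' hT hlow
  rw [norm_mul, ← hqdef, ← hK] at this
  rw [div_mul_eq_mul_div, div_le_iff₀ hK0]
  exact this

theorem exp_two_pi_I_eq_one_iff {ξ : ℂ} :
    Complex.exp (2 * Real.pi * Complex.I * ξ) = 1 ↔ ∃ n : ℤ, ξ = n := by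
  rw [Complex.exp_eq_one_iff]
  have := Complex.two_pi_I_ne_zero
  refine exists_congr fun n => ?_
  rw [mul_comm (n : ℂ), mul_right_inj' this]

theorem thetaC_ne_zero {τ ξ : ℂ} (h : |ξ.im| < τ.im) (hξ : ∀ n : ℤ, ξ ≠ n) : thetaC τ ξ ≠ 0 := by
  obtain ⟨c, hc, hle⟩ := exists_le_norm_thetaC (abs_nonneg ξ.im) h
  have h1 : Complex.exp (2 * Real.pi * Complex.I * ξ) - 1 ≠ 0 := fun h0 => by
    obtain ⟨n, hn⟩ := exp_two_pi_I_eq_one_iff.1 (sub_eq_zero.1 h0)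
    exact hξ n hn
  exact norm_pos_iff.1 ((mul_pos hc (norm_pos_iff.2 h1)).trans_le (hle ξ le_rfl))

theorem thetaC_ne_zero_of_norm_lt {τ ξ : ℂ} (h : ‖ξ‖ < τ.im) (h1 : ‖ξ‖ < 1) (h0 : ξ ≠ 0) :
    thetaC τ ξ ≠ 0 := by
  refine thetaC_ne_zero ((Complex.abs_im_le_norm ξ).trans_lt h) ?_
  rintro n rfl
  rw [Complex.norm_intCast] at h1
  have : |n| < 1 := by exact_mod_cast h1
  rw [Int.abs_lt_one_iff] at this
  exact h0 (by simp [this])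

theorem thetaC_ofReal_ne_zero {τ : ℂ} (hτ : 0 < τ.im) {s : ℝ} (hs : s ∈ Set.Ioo (0 : ℝ) 1) :
    thetaC τ s ≠ 0 := by
  refine thetaC_ne_zero (by simpa using hτ) ?_
  intro n hn
  have : s = n := by exact_mod_cast hn
  rw [this] at hs
  have h1 : (0 : ℤ) < n := by exact_mod_cast hs.1
  have h2 : n < (1 : ℤ) := by exact_mod_cast hs.2
  omega

/-- Dividing the lower bound by `|ξ|` and letting `ξ → 0` along the reals gives `|θ'(0)| ≥ 2πc`; the
strip with `y = 0` is enough. -/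
theorem deriv_thetaC_zero_ne_zero {τ : ℂ} (hτ : 0 < τ.im) : deriv (thetaC τ) 0 ≠ 0 := by
  obtain ⟨c, hc, hle⟩ := exists_le_norm_thetaC le_rfl hτ
  have h1 := ((differentiable_thetaC hτ 0).hasDerivAt).tendsto_slope_zero.norm
  have h2 : HasDerivAt (fun ξ : ℂ => Complex.exp (2 * Real.pi * Complex.I * ξ))
      (2 * Real.pi * Complex.I) 0 := by
    have := ((hasDerivAt_id (0 : ℂ)).const_mul (2 * Real.pi * Complex.I)).cexp
    simpa using this
  have h3 := h2.tendsto_slope_zero.norm.const_mul c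
  have hr : Tendsto (fun t : ℝ => (t : ℂ)) (𝓝[≠] 0) (𝓝[≠] 0) := by
    refine tendsto_nhdsWithin_iff.2 ⟨?_, ?_⟩
    · exact (Complex.continuous_ofReal.tendsto' 0 0 (by simp)).mono_left nhdsWithin_le_nhds
    · filter_upwards [self_mem_nhdsWithin] with t ht
      exact Complex.ofReal_ne_zero.2 ht
  have := le_of_tendsto_of_tendsto (h3.comp hr) (h1.comp hr) (Eventually.of_forall fun t => ?_)
  · intro h0
    rw [h0, norm_zero] at this
    have h4 : 0 < c * ‖(2 * Real.pi * Complex.I : ℂ)‖ :=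
      mul_pos hc (norm_pos_iff.2 Complex.two_pi_I_ne_zero)
    linarith
  · have := hle t (by simp)
    simp only [Function.comp, zero_add, mul_zero, Complex.exp_zero, thetaC_zero, sub_zero, norm_smul]
    rw [mul_left_comm]
    gcongr

end EllMZV

namespace EllMZV

/-! ### The functions `f^(k)` -/

theorem isOpen_im_pos : IsOpen {z : ℂ | 0 < z.im} :=
  isOpen_lt continuous_const Complex.continuous_im

/-- Cauchy's formula on the unit circle turns the derivative into an integral of `θ` itself, which
is jointly holomorphic. -/
theorem differentiableOn_deriv_thetaC_zero :
    DifferentiableOn ℂ (fun τ => deriv (thetaC τ) 0) {τ | 0 < τ.im} := by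
  have hU := isOpen_im_pos
  have h := differentiableOn_circleIntegral hU zero_le_one
    (K := fun τ α => (1 / (α - 0) ^ 2) * thetaC τ α) ?_ ?_
  · refine (h.const_smul (2 * Real.pi * Complex.I : ℂ)⁻¹).congr fun τ hτ => ?_
    have := (differentiable_thetaC hτ).diffContOnCl.deriv_eq_smul_circleIntegral
      (c := 0) zero_lt_one
    simp only [Pi.smul_apply, ← smul_eq_mul (1 / (_ : ℂ) ^ 2)]
    rw [this, inv_smul_smul₀ Complex.two_pi_I_ne_zero]
  · rintro ⟨τ, α⟩ ⟨hτ, hα⟩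
    have hα0 : α ≠ 0 := by rintro rfl; simp at hα
    have h1 := (differentiableAt_thetaC hτ α).continuousAt
    refine ContinuousAt.continuousWithinAt (ContinuousAt.mul ?_ h1)
    refine ContinuousAt.div (by fun_prop) (by fun_prop) ?_
    simpa using hα0
  · intro α hα τ hτ
    refine (DifferentiableAt.const_mul ?_ _).differentiableWithinAt
    exact (differentiableAt_thetaC hτ α).comp τ (f := fun x => (x, α)) (by fun_prop)

/-- The Kronecker series with `τ` an arbitrary complex number. -/
def kroneckerC (τ ξ α : ℂ) : ℂ :=
  deriv (thetaC τ) 0 * thetaC τ (ξ + α) / (thetaC τ ξ * thetaC τ α)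

theorem continuousAt_kroneckerC {τ ξ α : ℂ} (hτ : 0 < τ.im) (hξ : thetaC τ ξ ≠ 0)
    (hα : thetaC τ α ≠ 0) :
    ContinuousAt (fun p : ℂ × ℂ × ℂ => kroneckerC p.1 p.2.1 p.2.2) (τ, ξ, α) := by
  have hU := isOpen_im_pos
  have h0 : ContinuousAt (fun p : ℂ × ℂ × ℂ => deriv (thetaC p.1) 0) (τ, ξ, α) :=
    ContinuousAt.comp (f := fun p : ℂ × ℂ × ℂ => p.1) (x := (τ, ξ, α))
      (differentiableOn_deriv_thetaC_zero.continuousOn.continuousAt (hU.mem_nhds hτ))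
      continuousAt_fst
  have h : ∀ g : ℂ × ℂ × ℂ → ℂ, ContinuousAt g (τ, ξ, α) →
      ContinuousAt (fun p : ℂ × ℂ × ℂ => thetaC p.1 (g p)) (τ, ξ, α) := fun g hg =>
    ContinuousAt.comp (f := fun p : ℂ × ℂ × ℂ => (p.1, g p)) (x := (τ, ξ, α))
      (differentiableAt_thetaC hτ (g (τ, ξ, α))).continuousAt (by fun_prop)
  exact (h0.mul (h (fun p => p.2.1 + p.2.2) (by fun_prop))).div
    ((h (fun p => p.2.1) (by fun_prop)).mul (h (fun p => p.2.2) (by fun_prop)))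
    (mul_ne_zero hξ hα)

theorem differentiableAt_kroneckerC_tau {τ ξ α : ℂ} (hτ : 0 < τ.im) (hξ : thetaC τ ξ ≠ 0)
    (hα : thetaC τ α ≠ 0) : DifferentiableAt ℂ (fun τ => kroneckerC τ ξ α) τ := by
  have hU := isOpen_im_pos
  have h : ∀ x, DifferentiableAt ℂ (fun τ => thetaC τ x) τ := fun x =>
    (differentiableAt_thetaC hτ x).comp τ (f := fun y => (y, x)) (by fun_prop)
  exact ((differentiableOn_deriv_thetaC_zero.differentiableAt (hU.mem_nhds hτ)).mul (h _)).div
    ((h _).mul (h _)) (mul_ne_zero hξ hα)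

theorem differentiableAt_kroneckerC_xi {τ ξ : ℂ} (α : ℂ) (hτ : 0 < τ.im) (hξ : thetaC τ ξ ≠ 0)
    (hα : thetaC τ α ≠ 0) : DifferentiableAt ℂ (fun ξ => kroneckerC τ ξ α) ξ := by
  have h := differentiable_thetaC hτ
  refine DifferentiableAt.div ?_ ?_ (mul_ne_zero hξ hα)
  · exact ((h (ξ + α)).comp ξ (by fun_prop : DifferentiableAt ℂ (fun x => x + α) ξ)).const_mul _
  · exact (h ξ).mul_const _

/-- `α ↦ α F_τ(ξ, α)` without its removable singularity. -/
def alphaKronecker (τ ξ α : ℂ) : ℂ :=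
  deriv (thetaC τ) 0 * thetaC τ (ξ + α) / (thetaC τ ξ * dslope (thetaC τ) 0 α)

theorem dslope_thetaC_of_ne (τ : ℂ) {α : ℂ} (hα : α ≠ 0) :
    dslope (thetaC τ) 0 α = thetaC τ α / α := by
  rw [dslope_of_ne _ hα, slope_def_field, thetaC_zero, sub_zero, sub_zero]

theorem alphaKronecker_of_ne (τ ξ : ℂ) {α : ℂ} (hα : α ≠ 0) :
    alphaKronecker τ ξ α = α * kroneckerC τ ξ α := by
  rw [alphaKronecker, kroneckerC, dslope_thetaC_of_ne τ hα]
  field_simp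

theorem dslope_thetaC_ne_zero {τ α : ℂ} (h : ‖α‖ < τ.im) (h1 : ‖α‖ < 1) :
    dslope (thetaC τ) 0 α ≠ 0 := by
  rcases eq_or_ne α 0 with rfl | hα
  · rw [dslope_same]
    exact deriv_thetaC_zero_ne_zero (by simpa using h)
  · rw [dslope_thetaC_of_ne τ hα]
    exact div_ne_zero (thetaC_ne_zero_of_norm_lt h h1 hα) hα

theorem differentiable_dslope_thetaC {τ : ℂ} (hτ : 0 < τ.im) :
    Differentiable ℂ (dslope (thetaC τ) 0) := by
  rw [← differentiableOn_univ, Complex.differentiableOn_dslope univ_mem, differentiableOn_univ]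
  exact differentiable_thetaC hτ

theorem differentiableAt_alphaKronecker {τ ξ α : ℂ} (hξ : thetaC τ ξ ≠ 0)
    (h : ‖α‖ < τ.im) (h1 : ‖α‖ < 1) : DifferentiableAt ℂ (alphaKronecker τ ξ) α := by
  have hτ : 0 < τ.im := (norm_nonneg α).trans_lt h
  refine DifferentiableAt.div ?_ ?_ (mul_ne_zero hξ (dslope_thetaC_ne_zero h h1))
  · exact ((differentiable_thetaC hτ (ξ + α)).comp α
      (by fun_prop : DifferentiableAt ℂ (fun x => ξ + x) α)).const_mul _
  · exact (differentiable_dslope_thetaC hτ α).const_mul _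

/-- On the real segment `r = 0`, so the non-holomorphic exponential factor equals `1`. -/
theorem alphaOmega_ofReal (τ : ℍ) {s : ℝ} (hs : s ∈ Set.Ioo (0 : ℝ) 1) :
    alphaOmega τ s = alphaKronecker τ s := by
  have hne : ∀ α : ℂ, α ≠ 0 → α * Omega τ s α = alphaKronecker τ s α := by
    intro α hα
    rw [alphaKronecker_of_ne _ _ hα]
    simp [Omega, kronecker, kroneckerC, theta_eq_thetaC]
  have hc : ContinuousAt (alphaKronecker τ s) 0 :=
    (differentiableAt_alphaKronecker (thetaC_ofReal_ne_zero τ.im_pos hs)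
      (by simpa using τ.im_pos) (by simp)).continuousAt
  have hl : limUnder (𝓝[≠] (0 : ℂ)) (fun α => α * Omega τ s α) = alphaKronecker τ s 0 := by
    refine Tendsto.limUnder_eq ((hc.tendsto.mono_left nhdsWithin_le_nhds).congr' ?_)
    filter_upwards [self_mem_nhdsWithin] with α hα using (hne α hα).symm
  funext α
  rcases eq_or_ne α 0 with rfl | hα
  · rw [alphaOmega, Function.update_self, hl]
  · rw [alphaOmega, Function.update_of_ne hα, hne α hα]

/-- The Taylor coefficients of `α F_τ(ξ, α)`. -/
def fC (τ : ℂ) (k : ℕ) (ξ : ℂ) : ℂ := iteratedDeriv k (alphaKronecker τ ξ) 0 / (k.factorial : ℂ)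

theorem f_ofReal (τ : ℍ) (k : ℕ) {s : ℝ} (hs : s ∈ Set.Ioo (0 : ℝ) 1) :
    f τ k s = fC τ k s := by
  rw [f, fC, alphaOmega_ofReal τ hs]

/-- This moves the evaluation from the singular point `α = 0` to a circle on which `θ(α) ≠ 0`. With
`ρ` fixed, continuity in `ξ` and holomorphy in `τ` become statements about parameter integrals. -/
theorem fC_eq_circleIntegral {τ ξ : ℂ} (hξ : thetaC τ ξ ≠ 0) {ρ : ℝ} (hρ : 0 < ρ) (h : ρ < τ.im)
    (h1 : ρ < 1) (k : ℕ) : fC τ k ξ = (2 * Real.pi * Complex.I)⁻¹ *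
      ∮ α in C(0, ρ), (1 / (α - 0) ^ (k + 1)) * (α * kroneckerC τ ξ α) := by
  have hd : DifferentiableOn ℂ (alphaKronecker τ ξ) (Metric.closedBall 0 ρ) := fun α hα => by
    rw [mem_closedBall_zero_iff] at hα
    exact (differentiableAt_alphaKronecker hξ (hα.trans_lt h)
      (hα.trans_lt h1)).differentiableWithinAt
  have := hd.circleIntegral_one_div_sub_center_pow_smul hρ k
  have e : (∮ α in C(0, ρ), (1 / (α - 0) ^ (k + 1)) * (α * kroneckerC τ ξ α)) =
      ∮ α in C(0, ρ), (1 / (α - 0) ^ (k + 1)) • alphaKronecker τ ξ α := by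
    refine circleIntegral.integral_congr hρ.le fun α hα => ?_
    have hα0 : α ≠ 0 := by rintro rfl; simp at hα; exact hρ.ne hα
    simp only [smul_eq_mul, alphaKronecker_of_ne τ ξ hα0]
  rw [e, this, fC, smul_eq_mul, ← mul_assoc, ← mul_div_assoc,
    inv_mul_cancel₀ Complex.two_pi_I_ne_zero]
  ring

theorem ne_zero_of_mem_sphere {ρ : ℝ} (hρ : 0 < ρ) {α : ℂ} (hα : α ∈ Metric.sphere (0 : ℂ) ρ) :
    α ≠ 0 := by
  rintro rfl
  simp at hα
  exact hρ.ne hα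

theorem thetaC_ne_zero_of_mem_sphere {τ : ℂ} {ρ : ℝ} (hρ : 0 < ρ) (h : ρ < τ.im) (h1 : ρ < 1)
    {α : ℂ} (hα : α ∈ Metric.sphere (0 : ℂ) ρ) : thetaC τ α ≠ 0 := by
  have hn : ‖α‖ = ρ := by simpa using hα
  exact thetaC_ne_zero_of_norm_lt (by rwa [hn]) (by rwa [hn]) (ne_zero_of_mem_sphere hρ hα)

theorem continuousOn_fC {τ : ℂ} (hτ : 0 < τ.im) (k : ℕ) :
    ContinuousOn (fun s : ℝ => fC τ k s) (Set.Ioo 0 1) := by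
  obtain ⟨ρ, hρ, hρ'⟩ := exists_between (lt_min hτ zero_lt_one)
  obtain ⟨h, h1⟩ := lt_min_iff.1 hρ'
  have hU : IsOpen {ξ : ℂ | thetaC τ ξ ≠ 0} :=
    isOpen_ne_fun (differentiable_thetaC hτ).continuous continuous_const
  have key := differentiableOn_circleIntegral hU hρ.le
    (K := fun ξ α => (1 / (α - 0) ^ (k + 1)) * (α * kroneckerC τ ξ α)) ?_ ?_
  · have h2 : ContinuousOn (fun ξ => fC τ k ξ) {ξ : ℂ | thetaC τ ξ ≠ 0} :=
      (key.continuousOn.const_mul (2 * Real.pi * Complex.I)⁻¹).congr fun ξ hξ =>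
        fC_eq_circleIntegral hξ hρ h h1 k
    exact h2.comp Complex.continuous_ofReal.continuousOn fun s hs => thetaC_ofReal_ne_zero hτ hs
  · rintro ⟨ξ, α⟩ ⟨hξ, hα⟩
    have hα0 := ne_zero_of_mem_sphere hρ hα
    have hk := ContinuousAt.comp (f := fun p : ℂ × ℂ => (τ, p.1, p.2)) (x := (ξ, α))
      (continuousAt_kroneckerC hτ hξ (thetaC_ne_zero_of_mem_sphere hρ h h1 hα)) (by fun_prop)
    refine ContinuousAt.continuousWithinAt (ContinuousAt.mul ?_ (continuousAt_snd.mul hk))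
    refine ContinuousAt.div (by fun_prop) (by fun_prop) ?_
    simpa using hα0
  · intro α hα ξ hξ
    exact (((differentiableAt_kroneckerC_xi α hτ hξ
      (thetaC_ne_zero_of_mem_sphere hρ h h1 hα)).const_mul α).const_mul _).differentiableWithinAt

theorem differentiableAt_fC {τ₀ : ℂ} (hτ : 0 < τ₀.im) (k : ℕ) {s : ℝ}
    (hs : s ∈ Set.Ioo (0 : ℝ) 1) : DifferentiableAt ℂ (fun τ => fC τ k s) τ₀ := by
  obtain ⟨ρ, hρ, hρ'⟩ := exists_between (lt_min hτ zero_lt_one)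
  obtain ⟨h, h1⟩ := lt_min_iff.1 hρ'
  have hU : IsOpen {τ : ℂ | ρ < τ.im} := isOpen_lt continuous_const Complex.continuous_im
  have key := differentiableOn_circleIntegral hU hρ.le
    (K := fun τ α => (1 / (α - 0) ^ (k + 1)) * (α * kroneckerC τ s α)) ?_ ?_
  · refine DifferentiableOn.differentiableAt (s := {τ : ℂ | ρ < τ.im}) ?_ (hU.mem_nhds h)
    exact (key.const_mul (2 * Real.pi * Complex.I)⁻¹).congr fun τ hτ' =>
      fC_eq_circleIntegral (thetaC_ofReal_ne_zero (hρ.trans hτ') hs) hρ hτ' h1 k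
  · rintro ⟨τ, α⟩ ⟨hτ', hα⟩
    have hα0 := ne_zero_of_mem_sphere hρ hα
    have hk := ContinuousAt.comp (f := fun p : ℂ × ℂ => (p.1, (s : ℂ), p.2)) (x := (τ, α))
      (continuousAt_kroneckerC (hρ.trans hτ') (thetaC_ofReal_ne_zero (hρ.trans hτ') hs)
        (thetaC_ne_zero_of_mem_sphere hρ hτ' h1 hα)) (by fun_prop)
    refine ContinuousAt.continuousWithinAt (ContinuousAt.mul ?_ (continuousAt_snd.mul hk))
    refine ContinuousAt.div (by fun_prop) (by fun_prop) ?_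
    simpa using hα0
  · intro α hα τ hτ'
    exact (((differentiableAt_kroneckerC_tau (hρ.trans hτ')
      (thetaC_ofReal_ne_zero (hρ.trans hτ') hs)
      (thetaC_ne_zero_of_mem_sphere hρ hτ' h1 hα)).const_mul α).const_mul _).differentiableWithinAt

/-! ### Behaviour of `f^(k)` at the ends of the segment -/

theorem dslope_thetaC_neg (τ α : ℂ) : dslope (thetaC τ) 0 (-α) = dslope (thetaC τ) 0 α := by
  rcases eq_or_ne α 0 with rfl | hα
  · simp
  · rw [dslope_thetaC_of_ne τ hα, dslope_thetaC_of_ne τ (neg_ne_zero.2 hα), thetaC_neg, neg_div_neg_eq]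

theorem thetaC_one_sub (τ ξ : ℂ) : thetaC τ (1 - ξ) = thetaC τ ξ := by
  rw [show 1 - ξ = -ξ + 1 by ring, thetaC_add_one, thetaC_neg, neg_neg]

/-- Oddness and antiperiodicity of `θ` give `F(1 - ξ, α) = -F(ξ, -α)`. Estimates near `0` thereby
carry over to `1`, the pole of `f^(1)` changing sign. -/
theorem fC_one_sub (τ : ℂ) (k : ℕ) (ξ : ℂ) : fC τ k (1 - ξ) = (-1) ^ k * fC τ k ξ := by
  have h : alphaKronecker τ (1 - ξ) = fun α => alphaKronecker τ ξ (-α) := by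
    funext α
    rw [alphaKronecker, alphaKronecker, dslope_thetaC_neg, thetaC_one_sub,
      show 1 - ξ + α = 1 - (ξ + -α) by ring, thetaC_one_sub]
  rw [fC, fC, h, iteratedDeriv_comp_neg, neg_zero, smul_eq_mul, mul_div_assoc]

/-- The Kronecker series minus its polar part is bounded for small `ξ`. -/
theorem exists_norm_kroneckerC_sub_le {τ₀ : ℂ} (hτ : 0 < τ₀.im) :
    ∃ ρ > 0, ρ < 1 ∧ ∃ C, ∀ᶠ τ in 𝓝 τ₀, ρ < τ.im ∧ ∀ s ∈ Set.Ioc (0 : ℝ) (1 / 2),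
      ∀ α ∈ Metric.sphere (0 : ℂ) ρ, ‖kroneckerC τ s α - 1 / s‖ ≤ C := by
  obtain ⟨ρ, hρ, hρ'⟩ := exists_between (lt_min hτ zero_lt_one)
  obtain ⟨h, h1⟩ := lt_min_iff.1 hρ'
  have hU : IsOpen {τ : ℂ | ρ < τ.im} := isOpen_lt continuous_const Complex.continuous_im
  obtain ⟨ε, hε, hsub⟩ := Metric.nhds_basis_closedBall.mem_iff.1 (hU.mem_nhds h)
  have hcont : ∀ S : Set ℂ, (∀ τ ∈ Metric.closedBall τ₀ ε, ∀ ξ ∈ S, thetaC τ ξ ≠ 0) →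
      (∀ ξ ∈ S, ξ ≠ 0) → ContinuousOn (fun p : ℂ × ℂ × ℂ => kroneckerC p.1 p.2.1 p.2.2 - 1 / p.2.1)
        (Metric.closedBall τ₀ ε ×ˢ S ×ˢ Metric.sphere (0 : ℂ) ρ) := by
    rintro S hS hS0 ⟨τ, ξ, α⟩ ⟨hτ', hξ, hα⟩
    refine ContinuousAt.continuousWithinAt (ContinuousAt.sub ?_ ?_)
    · exact continuousAt_kroneckerC (hρ.trans (hsub hτ')) (hS τ hτ' ξ hξ)
        (thetaC_ne_zero_of_mem_sphere hρ (hsub hτ') h1 hα)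
    · exact ContinuousAt.div (by fun_prop) (by fun_prop) (hS0 ξ hξ)
  have hc1 := hcont (Metric.sphere 0 ρ)
    (fun τ hτ' ξ hξ => thetaC_ne_zero_of_mem_sphere hρ (hsub hτ') h1 hξ)
    (fun ξ hξ => ne_zero_of_mem_sphere hρ hξ)
  have hc2 := hcont (Complex.ofReal '' Set.Icc ρ (1 / 2))
    (by
      rintro τ hτ' _ ⟨s, hs, rfl⟩
      exact thetaC_ofReal_ne_zero (hρ.trans (hsub hτ')) ⟨hρ.trans_le hs.1, by linarith [hs.2]⟩)
    (by
      rintro _ ⟨s, hs, rfl⟩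
      exact Complex.ofReal_ne_zero.2 (hρ.trans_le hs.1).ne')
  obtain ⟨C₁, hC₁⟩ := ((isCompact_closedBall τ₀ ε).prod ((isCompact_sphere (0 : ℂ) ρ).prod
    (isCompact_sphere (0 : ℂ) ρ))).exists_bound_of_continuousOn hc1
  obtain ⟨C₂, hC₂⟩ := ((isCompact_closedBall τ₀ ε).prod ((isCompact_Icc.image
    Complex.continuous_ofReal).prod (isCompact_sphere (0 : ℂ) ρ))).exists_bound_of_continuousOn hc2
  refine ⟨ρ, hρ, h1, max C₁ C₂, eventually_of_mem (Metric.closedBall_mem_nhds τ₀ hε)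
    fun τ hτ' => ⟨hsub hτ', fun s hs α hα => ?_⟩⟩
  -- For `s ≥ ρ` compactness suffices. For `s < ρ` the function `F(ξ, α) - 1/ξ` extends
  -- holomorphically over the disc `|ξ| ≤ ρ`, and the maximum principle bounds it by its values on
  -- the circle, again a compact set.
  rcases le_or_gt ρ s with hρs | hsρ
  · exact (hC₂ (τ, s, α) ⟨hτ', ⟨s, ⟨hρs, hs.2⟩, rfl⟩, hα⟩).trans (le_max_right _ _)
  · refine le_trans ?_ (le_max_left _ _)
    have hτp : 0 < τ.im := hρ.trans (hsub hτ')
    have hα0 := thetaC_ne_zero_of_mem_sphere hρ (hsub hτ') h1 hα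
    -- `ξ F(ξ, α)`, with value `1` at `ξ = 0`
    set m : ℂ → ℂ := fun ξ => deriv (thetaC τ) 0 * thetaC τ (ξ + α) /
      (dslope (thetaC τ) 0 ξ * thetaC τ α) with hm
    have hmd : DifferentiableOn ℂ m (Metric.closedBall 0 ρ) := by
      intro ξ hξ
      rw [mem_closedBall_zero_iff] at hξ
      refine DifferentiableAt.differentiableWithinAt (DifferentiableAt.div ?_ ?_
        (mul_ne_zero (dslope_thetaC_ne_zero (hξ.trans_lt (hsub hτ')) (hξ.trans_lt h1)) hα0))
      · exact ((differentiable_thetaC hτp (ξ + α)).comp ξ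
          (by fun_prop : DifferentiableAt ℂ (fun x => x + α) ξ)).const_mul _
      · exact (differentiable_dslope_thetaC hτp ξ).mul_const _
    have hm0 : m 0 = 1 := by
      simp only [hm, dslope_same, zero_add]
      exact div_self (mul_ne_zero (deriv_thetaC_zero_ne_zero hτp) hα0)
    have hmn : ∀ ξ : ℂ, ξ ≠ 0 → dslope m 0 ξ = kroneckerC τ ξ α - 1 / ξ := by
      intro ξ hξ
      rw [dslope_of_ne _ hξ, slope_def_field, hm0]
      simp only [hm, dslope_thetaC_of_ne τ hξ, kroneckerC, sub_zero]
      rw [sub_div]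
      congr 1
      field_simp
    have hdm : DifferentiableOn ℂ (dslope m 0) (Metric.closedBall 0 ρ) :=
      (Complex.differentiableOn_dslope (Metric.closedBall_mem_nhds _ hρ)).2 hmd
    have hs0 : (s : ℂ) ≠ 0 := Complex.ofReal_ne_zero.2 hs.1.ne'
    rw [← hmn s hs0]
    refine Complex.norm_le_of_forall_mem_frontier_norm_le (U := Metric.ball 0 ρ)
      Metric.isBounded_ball (hdm.mono Metric.closure_ball_subset_closedBall).diffContOnCl
      (fun ξ hξ => ?_) (subset_closure ?_)
    · rw [frontier_ball _ hρ.ne'] at hξ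
      rw [hmn ξ (ne_zero_of_mem_sphere hρ hξ)]
      exact hC₁ (τ, ξ, α) ⟨hτ', hξ, hα⟩
    · rw [mem_ball_zero_iff, Complex.norm_real, Real.norm_of_nonneg hs.1.le]
      exact hsρ

/-- Cauchy's estimate for `α (F(s, α) - 1/s)` on `|α| = ρ`: the polar part contributes `α/s`, which
has a Taylor coefficient only at `k = 1`. -/
theorem exists_norm_fC_sub_le {τ₀ : ℂ} (hτ : 0 < τ₀.im) (k : ℕ) :
    ∃ C, ∀ᶠ τ in 𝓝 τ₀, ∀ s ∈ Set.Ioc (0 : ℝ) (1 / 2),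
      ‖fC τ k s - (if k = 1 then 1 / (s : ℂ) else 0)‖ ≤ C := by
  obtain ⟨ρ, hρ, h1, C, hC⟩ := exists_norm_kroneckerC_sub_le hτ
  refine ⟨ρ * C / ρ ^ k, hC.mono fun τ ⟨hτ', hle⟩ s hs => ?_⟩
  have hs0 : (s : ℂ) ≠ 0 := Complex.ofReal_ne_zero.2 hs.1.ne'
  have hsθ : thetaC τ s ≠ 0 :=
    thetaC_ofReal_ne_zero (hρ.trans hτ') ⟨hs.1, by linarith [hs.2]⟩
  have hd : DifferentiableOn ℂ (alphaKronecker τ s) (Metric.closedBall 0 ρ) := fun α hα => by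
    rw [mem_closedBall_zero_iff] at hα
    exact (differentiableAt_alphaKronecker hsθ (hα.trans_lt hτ')
      (hα.trans_lt h1)).differentiableWithinAt
  have hcd : ContDiffAt ℂ k (alphaKronecker τ s) 0 :=
    (hd.analyticAt (Metric.closedBall_mem_nhds _ hρ)).contDiffAt
  have hb := Complex.norm_iteratedDeriv_le_of_forall_mem_sphere_norm_le k hρ
    (f := fun α => alphaKronecker τ s α - (1 / (s : ℂ)) * α) (c := 0) (C := ρ * C)
    (((hd.sub (by fun_prop)).mono Metric.closure_ball_subset_closedBall).diffContOnCl)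
    (fun α hα => by
      rw [alphaKronecker_of_ne _ _ (ne_zero_of_mem_sphere hρ hα), mul_comm (1 / (s : ℂ)),
        ← mul_sub, norm_mul, mem_sphere_zero_iff_norm.1 hα]
      exact mul_le_mul_of_nonneg_left (hle s hs α hα) hρ.le)
  have hid : iteratedDeriv k (fun α : ℂ => (1 / (s : ℂ)) * α) 0 = if k = 1 then 1 / (s : ℂ) else 0 := by
    rw [iteratedDeriv_const_mul_field]
    have := @iteratedDeriv_id ℂ _ k 0
    rw [show (fun α : ℂ => α) = id from rfl, this]
    rcases eq_or_ne k 0 with rfl | h0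
    · simp
    · simp [h0]
  rw [iteratedDeriv_fun_sub hcd (by fun_prop), hid] at hb
  have hfac : ((k.factorial : ℂ)) ≠ 0 := Nat.cast_ne_zero.2 k.factorial_ne_zero
  have e : fC τ k s - (if k = 1 then 1 / (s : ℂ) else 0) =
      (iteratedDeriv k (alphaKronecker τ s) 0 - (if k = 1 then 1 / (s : ℂ) else 0)) / k.factorial := by
    rw [fC, sub_div]
    congr 1
    split_ifs with h
    · simp [h]
    · simp
  rw [e, norm_div, Complex.norm_natCast, div_le_iff₀ (by positivity)]
  calc _ ≤ _ := hb
    _ = _ := by ring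

end EllMZV

namespace EllMZV

/-! ### Series in non-commuting variables -/

/-- Formal series in the non-commuting letters `α`, with the concatenation product. -/
structure Ser (α : Type) where
  /-- the coefficient at a word -/
  coeff : List α → ℂ

namespace Ser

variable {α : Type}

instance : CoeFun (Ser α) fun _ => List α → ℂ := ⟨coeff⟩

@[ext] theorem ext {S T : Ser α} (h : ∀ w, S w = T w) : S = T := by
  cases S; cases T; congr; exact funext h

theorem coeff_injective : Function.Injective (coeff : Ser α → List α → ℂ) := fun _ _ h =>
  ext (congrFun h)

instance : Zero (Ser α) := ⟨⟨0⟩⟩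
instance : Add (Ser α) := ⟨fun S T => ⟨S.coeff + T.coeff⟩⟩
instance : Neg (Ser α) := ⟨fun S => ⟨-S.coeff⟩⟩
instance : Sub (Ser α) := ⟨fun S T => ⟨S.coeff - T.coeff⟩⟩
instance : SMul ℂ (Ser α) := ⟨fun c S => ⟨c • S.coeff⟩⟩
instance : SMul ℕ (Ser α) := ⟨fun c S => ⟨c • S.coeff⟩⟩
instance : SMul ℤ (Ser α) := ⟨fun c S => ⟨c • S.coeff⟩⟩

instance : AddCommGroup (Ser α) := coeff_injective.addCommGroup _ rfl (fun _ _ => rfl)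
  (fun _ => rfl) (fun _ _ => rfl) (fun _ _ => rfl) (fun _ _ => rfl)

instance : Module ℂ (Ser α) :=
  coeff_injective.module ℂ ⟨⟨coeff, rfl⟩, fun _ _ => rfl⟩ (fun _ _ => rfl)

instance : One (Ser α) := ⟨⟨fun
  | [] => 1
  | _ => 0⟩⟩

instance : Mul (Ser α) :=
  ⟨fun S T => ⟨fun w => ∑ i ∈ Finset.range (w.length + 1), S (w.take i) * T (w.drop i)⟩⟩

/-- The series of the coefficients at the words that begin with `a`. -/
def shift (a : α) (S : Ser α) : Ser α := ⟨fun w => S (a :: w)⟩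

@[simp] theorem add_apply (S T : Ser α) (w : List α) : (S + T) w = S w + T w := rfl
@[simp] theorem sub_apply (S T : Ser α) (w : List α) : (S - T) w = S w - T w := rfl
@[simp] theorem neg_apply (S : Ser α) (w : List α) : (-S) w = -S w := rfl
@[simp] theorem zero_apply (w : List α) : (0 : Ser α) w = 0 := rfl
@[simp] theorem smul_apply (c : ℂ) (S : Ser α) (w : List α) : (c • S) w = c * S w := rfl
@[simp] theorem one_nil : (1 : Ser α) [] = 1 := rfl
@[simp] theorem one_cons (a : α) (w : List α) : (1 : Ser α) (a :: w) = 0 := rfl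
@[simp] theorem shift_apply (a : α) (S : Ser α) (w : List α) : shift a S w = S (a :: w) := rfl

theorem mul_apply (S T : Ser α) (w : List α) :
    (S * T) w = ∑ i ∈ Finset.range (w.length + 1), S (w.take i) * T (w.drop i) := rfl

@[simp] theorem mul_nil (S T : Ser α) : (S * T) [] = S [] * T [] := by simp [mul_apply]

theorem mul_cons (S T : Ser α) (a : α) (w : List α) :
    (S * T) (a :: w) = S [] * T (a :: w) + (shift a S * T) w := by
  rw [mul_apply, mul_apply, List.length_cons, Finset.sum_range_succ', add_comm]
  rfl

theorem add_mul' (S S' T : Ser α) : (S + S') * T = S * T + S' * T := by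
  ext w
  simp only [mul_apply, add_apply, add_mul, Finset.sum_add_distrib]

theorem smul_mul' (c : ℂ) (S T : Ser α) : (c • S) * T = c • (S * T) := by
  ext w
  simp only [mul_apply, smul_apply, mul_assoc, Finset.mul_sum]

/-- Stripping the first letter obeys a twisted Leibniz rule; it drives the inductions on words for
associativity and for `shSum_mul`. -/
theorem shift_mul (a : α) (S T : Ser α) : shift a (S * T) = S [] • shift a T + shift a S * T := by
  ext w
  simp [mul_cons]

theorem mul_assoc' (S T R : Ser α) : S * T * R = S * (T * R) := by
  ext w
  induction w generalizing S with
  | nil => simp [mul_assoc]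
  | cons a w ih =>
    rw [mul_cons, mul_cons, shift_mul, add_mul', smul_mul', mul_cons T R, mul_nil]
    simp only [add_apply, smul_apply, ih]
    ring

theorem one_mul' (S : Ser α) : 1 * S = S := by
  ext w
  cases w with
  | nil => simp
  | cons a w =>
    have : shift a (1 : Ser α) = 0 := rfl
    rw [mul_cons, this, mul_apply]
    simp

theorem mul_one' (S : Ser α) : S * 1 = S := by
  ext w
  induction w generalizing S with
  | nil => simp
  | cons a w ih => rw [mul_cons, ih]; simp

instance : Ring (Ser α) :=
  { (inferInstance : AddCommGroup (Ser α)) with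
    mul_assoc := mul_assoc'
    one_mul := one_mul'
    mul_one := mul_one'
    left_distrib := fun S T R => by
      ext w; simp only [mul_apply, add_apply, mul_add, Finset.sum_add_distrib]
    right_distrib := add_mul'
    zero_mul := fun S => by ext w; simp [mul_apply]
    mul_zero := fun S => by ext w; simp [mul_apply] }

/-- The series `∑ g(a) a`. -/
def letter (g : α → ℂ) : Ser α := ⟨fun
  | [a] => g a
  | _ => 0⟩

@[simp] theorem letter_nil (g : α → ℂ) : letter g [] = 0 := rfl
@[simp] theorem letter_singleton (g : α → ℂ) (a : α) : letter g [a] = g a := rfl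
@[simp] theorem letter_cons_cons (g : α → ℂ) (a b : α) (w : List α) :
    letter g (a :: b :: w) = 0 := rfl

theorem shift_letter (g : α → ℂ) (a : α) : shift a (letter g) = g a • 1 := by
  ext w
  cases w <;> simp

theorem letter_mul_cons (g : α → ℂ) (S : Ser α) (a : α) (w : List α) :
    (letter g * S) (a :: w) = g a * S w := by
  rw [mul_cons, shift_letter, smul_mul', one_mul]
  simp

theorem mul_letter_concat (g : α → ℂ) (S : Ser α) (w : List α) (a : α) :
    (S * letter g) (w ++ [a]) = S w * g a := by
  induction w generalizing S with
  | nil => simp [mul_cons]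
  | cons b w ih =>
    rw [List.cons_append, mul_cons, ih, shift_apply]
    cases w <;> simp

theorem neg_letter (g : α → ℂ) : -letter g = letter (-g) := by
  ext w
  rcases w with _ | ⟨a, _ | ⟨b, w⟩⟩ <;> simp

theorem add_letter (g h : α → ℂ) : letter g + letter h = letter (g + h) := by
  ext w
  rcases w with _ | ⟨a, _ | ⟨b, w⟩⟩ <;> simp

theorem sub_letter (g h : α → ℂ) : letter g - letter h = letter (g - h) := by
  rw [sub_eq_add_neg, neg_letter, add_letter, sub_eq_add_neg]

/-! ### Coefficientwise derivatives -/

/-- The series `F t` has coefficientwise derivative `F'` at `t`. -/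
def HasD (F : ℝ → Ser α) (F' : Ser α) (t : ℝ) : Prop :=
  ∀ w, HasDerivAt (fun t => F t w) (F' w) t

theorem HasD.mul {F G : ℝ → Ser α} {F' G' : Ser α} {t : ℝ} (hF : HasD F F' t) (hG : HasD G G' t) :
    HasD (fun t => F t * G t) (F' * G t + F t * G') t := by
  intro w
  simp only [mul_apply, add_apply, ← Finset.sum_add_distrib]
  exact HasDerivAt.fun_sum fun i _ => (hF _).mul (hG _)

theorem HasD.scomp {F : ℝ → Ser α} {F' : Ser α} {φ : ℝ → ℝ} {φ' t : ℝ} (hF : HasD F F' (φ t))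
    (hφ : HasDerivAt φ φ' t) : HasD (fun t => F (φ t)) ((φ' : ℂ) • F') t := by
  intro w
  have := HasDerivAt.scomp t (hF w) hφ
  rw [Complex.real_smul] at this
  exact this

end Ser

theorem eq_of_hasDerivAt_zero {s : Set ℝ} (hs : IsOpen s) (hs' : IsPreconnected s) {h : ℝ → ℂ}
    (hd : ∀ t ∈ s, HasDerivAt h 0 t) {a b : ℝ} (ha : a ∈ s) (hb : b ∈ s) : h a = h b :=
  hs.is_const_of_deriv_eq_zero hs'
    (fun t ht => (hd t ht).differentiableAt.differentiableWithinAt)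
    (fun t ht => (hd t ht).deriv) ha hb

open Ser

theorem Ser.eq_of_hasD_zero {α : Type} {s : Set ℝ} (hs : IsOpen s) (hs' : IsPreconnected s)
    {F : ℝ → Ser α} (hd : ∀ t ∈ s, HasD F 0 t) {a b : ℝ} (ha : a ∈ s) (hb : b ∈ s) : F a = F b :=
  Ser.ext fun w => eq_of_hasDerivAt_zero hs hs' (fun t ht => hd t ht w) ha hb

/-! ### Shuffle characters -/

/-- The sum of the coefficients at the shuffles of `u` and `v`. -/
def shSum (c : Ser ℕ) (u v : List ℕ) : ℂ := ((shuffle u v).map c.coeff).sum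

@[simp] theorem shuffle_nil_left (v : List ℕ) : shuffle [] v = [v] := by simp [shuffle]

@[simp] theorem shuffle_nil_right (u : List ℕ) : shuffle u [] = [u] := by
  cases u <;> simp [shuffle]

theorem shuffle_cons_cons (a b : ℕ) (u v : List ℕ) : shuffle (a :: u) (b :: v) =
    (shuffle u (b :: v)).map (fun w => a :: w) ++ (shuffle (a :: u) v).map (fun w => b :: w) := by
  rw [shuffle]

@[simp] theorem shSum_nil_left (c : Ser ℕ) (v : List ℕ) : shSum c [] v = c v := by simp [shSum]

@[simp] theorem shSum_nil_right (c : Ser ℕ) (u : List ℕ) : shSum c u [] = c u := by simp [shSum]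

theorem shSum_cons_cons (c : Ser ℕ) (a b : ℕ) (u v : List ℕ) : shSum c (a :: u) (b :: v) =
    shSum (shift a c) u (b :: v) + shSum (shift b c) (a :: u) v := by
  rw [shSum, shuffle_cons_cons, List.map_append, List.sum_append, List.map_map, List.map_map]
  rfl

theorem shSum_add (c d : Ser ℕ) (u v : List ℕ) :
    shSum (c + d) u v = shSum c u v + shSum d u v :=
  List.sum_map_add (f := c.coeff) (g := d.coeff)

theorem shSum_smul (r : ℂ) (c : Ser ℕ) (u v : List ℕ) : shSum (r • c) u v = r * shSum c u v :=
  List.sum_map_mul_left _ c.coeff r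

/-- Series whose coefficients satisfy the shuffle product formula. -/
def IsChar (c : Ser ℕ) : Prop := ∀ u v, shSum c u v = c u * c v

/-- Cutting a shuffle of `u` and `v` in two amounts to cutting `u` and `v` and shuffling the pieces:
deconcatenation is compatible with the shuffle product. -/
theorem shSum_mul (c d : Ser ℕ) (u v : List ℕ) : shSum (c * d) u v =
    ∑ i ∈ Finset.range (u.length + 1), ∑ j ∈ Finset.range (v.length + 1),
      shSum c (u.take i) (v.take j) * shSum d (u.drop i) (v.drop j) := by
  induction hn : u.length + v.length using Nat.strong_induction_on generalizing c u v with
  | _ n ih =>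
    rcases u with _ | ⟨a, u⟩
    · simp [mul_apply]
    rcases v with _ | ⟨b, v⟩
    · simp [mul_apply]
    simp only [List.length_cons] at hn
    rw [shSum_cons_cons, shift_mul, shift_mul, shSum_add, shSum_add, shSum_smul, shSum_smul,
      ih (u.length + (b :: v).length) (by simp; omega) (shift a c) u (b :: v) rfl,
      ih ((a :: u).length + v.length) (by simp; omega) (shift b c) (a :: u) v rfl]
    simp only [List.length_cons, Finset.sum_range_succ' _ (u.length + 1),
      Finset.sum_range_succ' _ (v.length + 1), List.take_succ_cons, List.drop_succ_cons,
      List.take_zero, List.drop_zero, shSum_nil_left, shSum_nil_right, shSum_cons_cons c,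
      Finset.sum_add_distrib, add_mul, shift_apply]
    rw [shSum_cons_cons d]
    ring

theorem IsChar.mul {c d : Ser ℕ} (hc : IsChar c) (hd : IsChar d) : IsChar (c * d) := by
  intro u v
  rw [shSum_mul, mul_apply, mul_apply, Finset.sum_mul_sum]
  refine Finset.sum_congr rfl fun i _ => Finset.sum_congr rfl fun j _ => ?_
  rw [hc, hd]
  ring

theorem isChar_one : IsChar 1 := by
  rintro (_ | ⟨a, u⟩) (_ | ⟨b, v⟩)
  · simp
  · simp
  · simp
  · rw [shSum_cons_cons]
    have : ∀ a, shift a (1 : Ser ℕ) = (0 : ℂ) • 1 := fun a => by rw [zero_smul]; rfl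
    rw [this, this, shSum_smul, shSum_smul]
    simp

theorem hasDerivAt_shSum_shift {c : ℝ → Ser ℕ} {g : ℕ → ℂ} {t : ℝ}
    (hd : ∀ n ns, HasDerivAt (fun t => c t (n :: ns)) (g n * c t ns) t) (a : ℕ) (u v : List ℕ) :
    HasDerivAt (fun t => shSum (shift a (c t)) u v) (g a * shSum (c t) u v) t := by
  unfold shSum
  induction shuffle u v with
  | nil => simpa using hasDerivAt_const t (0 : ℂ)
  | cons w l ih =>
    simp only [List.map_cons, List.sum_cons, mul_add]
    exact (hd a w).add ih

/-- Solutions of a linear differential equation with a grouplike initial value are grouplike. -/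
theorem isChar_of_hasDerivAt {s : Set ℝ} (hs : IsOpen s) (hs' : IsPreconnected s)
    {c : ℝ → Ser ℕ} {g : ℕ → ℝ → ℂ} (hnil : ∀ t ∈ s, c t [] = 1)
    (hd : ∀ t ∈ s, ∀ n ns, HasDerivAt (fun t => c t (n :: ns)) (g n t * c t ns) t)
    {t₀ : ℝ} (ht₀ : t₀ ∈ s) (h₀ : IsChar (c t₀)) {t : ℝ} (ht : t ∈ s) : IsChar (c t) := by
  intro u v
  induction hn : u.length + v.length using Nat.strong_induction_on generalizing u v t with
  | _ n ih =>
    rcases u with _ | ⟨a, u⟩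
    · simp [hnil t ht]
    rcases v with _ | ⟨b, v⟩
    · simp [hnil t ht]
    simp only [List.length_cons] at hn
    -- Both sides of the shuffle formula have the same derivative, since the formula is known for
    -- shorter pairs of words; their difference is constant and vanishes at `t₀`.
    have key : ∀ r ∈ s, HasDerivAt
        (fun r => shSum (c r) (a :: u) (b :: v) - c r (a :: u) * c r (b :: v)) 0 r := by
      intro r hr
      have h1 := (hasDerivAt_shSum_shift (hd r hr) a u (b :: v)).add
        (hasDerivAt_shSum_shift (hd r hr) b (a :: u) v)
      have h2 := (hd r hr a u).mul (hd r hr b v)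
      have h3 := h1.sub h2
      simp only [shSum_cons_cons]
      refine h3.congr_deriv ?_
      rw [ih (u.length + (b :: v).length) (by simp; omega) hr u (b :: v) rfl,
        ih ((a :: u).length + v.length) (by simp; omega) hr (a :: u) v rfl]
      ring
    have := eq_of_hasDerivAt_zero hs hs' key ht ht₀
    rw [h₀ (a :: u) (b :: v), sub_self] at this
    exact sub_eq_zero.1 this

/-! ### The exponential of a multiple of the letter `1` -/

-- The coefficients see a word only through its length and whether all its letters are `1`. A letter
-- may therefore be removed at either end.
open Classical in
/-- The exponential of `l` times the letter `1`. -/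
def expSer (l : ℂ) : Ser ℕ := ⟨fun w =>
  if ∀ n ∈ w, n = 1 then l ^ w.length / (w.length.factorial : ℂ) else 0⟩

/-- The function with the value `a` at `1` and the value `0` elsewhere. -/
def atOne (a : ℂ) : ℕ → ℂ := fun n => if n = 1 then a else 0

@[simp] theorem expSer_nil (l : ℂ) : expSer l [] = 1 := by simp [expSer]

theorem hasDerivAt_expSer_perm {φ : ℝ → ℂ} {φ' : ℂ} {t : ℝ} (h : HasDerivAt φ φ' t) {n : ℕ}
    {w w' : List ℕ} (hw : w'.Perm (n :: w)) :
    HasDerivAt (fun t => expSer (φ t) w') (atOne φ' n * expSer (φ t) w) t := by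
  have h1 : (∀ m ∈ w', m = 1) ↔ n = 1 ∧ ∀ m ∈ w, m = 1 := by
    simp [hw.mem_iff]
  simp only [expSer, atOne, h1, hw.length_eq, List.length_cons]
  by_cases hn : n = 1
  · by_cases hw : ∀ m ∈ w, m = 1
    · simp only [hn, eq_true hw, and_self, if_true]
      refine ((h.fun_pow (w.length + 1)).div_const _).congr_deriv ?_
      have : ((w.length.factorial : ℂ)) ≠ 0 := Nat.cast_ne_zero.2 (Nat.factorial_ne_zero _)
      have h' : (w.length : ℂ) + 1 ≠ 0 := Nat.cast_add_one_ne_zero _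
      rw [Nat.factorial_succ]
      push_cast
      field_simp
    · simpa [hw] using hasDerivAt_const t (0 : ℂ)
  · simpa [hn] using hasDerivAt_const t (0 : ℂ)

theorem hasD_expSer_left {φ : ℝ → ℂ} {φ' : ℂ} {t : ℝ} (h : HasDerivAt φ φ' t) :
    HasD (fun t => expSer (φ t)) (letter (atOne φ') * expSer (φ t)) t := by
  rintro (_ | ⟨n, w⟩)
  · simpa using hasDerivAt_const t (1 : ℂ)
  · rw [letter_mul_cons]
    exact hasDerivAt_expSer_perm h (List.Perm.refl _)

theorem hasD_expSer_right {φ : ℝ → ℂ} {φ' : ℂ} {t : ℝ} (h : HasDerivAt φ φ' t) :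
    HasD (fun t => expSer (φ t)) (expSer (φ t) * letter (atOne φ')) t := by
  intro w
  induction w using List.reverseRecOn with
  | nil => simpa using hasDerivAt_const t (1 : ℂ)
  | append_singleton w n _ =>
    rw [mul_letter_concat, mul_comm]
    exact hasDerivAt_expSer_perm h (List.perm_append_singleton n w)

theorem expSer_zero : expSer 0 = 1 := by
  ext w
  rcases w with _ | ⟨n, w⟩
  · simp
  · simp [expSer]

theorem atOne_neg (a : ℂ) : atOne (-a) = -atOne a := by
  funext n
  simp only [atOne, Pi.neg_apply]
  split_ifs <;> simp

theorem hasDerivAt_ofReal_mul (l : ℂ) (t : ℝ) : HasDerivAt (fun t : ℝ => (t : ℂ) * l) l t := by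
  simpa using (Complex.ofRealCLM.hasDerivAt (x := t)).mul_const l

/-- Differentiating the first factor on its right and the second on its left makes the two
contributions cancel between the factors. -/
theorem expSer_neg_mul (l : ℂ) : expSer (-l) * expSer l = 1 := by
  have key : ∀ t ∈ Set.univ, HasD (fun t : ℝ => expSer (t * -l) * expSer (t * l)) 0 t := by
    intro t _
    have := (hasD_expSer_right (hasDerivAt_ofReal_mul (-l) t)).mul
      (hasD_expSer_left (hasDerivAt_ofReal_mul l t))
    convert this using 1
    rw [atOne_neg, ← neg_letter, mul_neg, neg_mul, mul_assoc, neg_add_cancel]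
  have := Ser.eq_of_hasD_zero isOpen_univ isPreconnected_univ key (Set.mem_univ 1) (Set.mem_univ 0)
  simpa [expSer_zero] using this

theorem isChar_expSer (l : ℂ) : IsChar (expSer l) := by
  have := isChar_of_hasDerivAt isOpen_univ isPreconnected_univ (c := fun t => expSer (t * l))
    (g := fun n _ => atOne l n) (fun _ _ => expSer_nil _)
    (fun t _ n ns => hasDerivAt_expSer_perm (hasDerivAt_ofReal_mul l t) (List.Perm.refl _))
    (Set.mem_univ 0) (by simpa [expSer_zero] using isChar_one) (Set.mem_univ 1)
  simpa using this

end EllMZV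

namespace EllMZV

open Ser

/-! ### Expansions in the products of the `ad^n(x)(y)` -/

theorem NC.mul_eq (S T : NC) : NC.mul S T = ((⟨S⟩ : Ser Letter) * ⟨T⟩).coeff := rfl

theorem NC.one_eq : NC.one = (1 : Ser Letter).coeff := by
  funext w
  cases w <;> rfl

theorem NC.mul_assoc (S T R : NC) : NC.mul (NC.mul S T) R = NC.mul S (NC.mul T R) :=
  congrArg coeff (_root_.mul_assoc (⟨S⟩ : Ser Letter) ⟨T⟩ ⟨R⟩)

theorem NC.one_mul (S : NC) : NC.mul NC.one S = S := by
  rw [NC.one_eq]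
  exact congrArg coeff (_root_.one_mul (⟨S⟩ : Ser Letter))

theorem NC.mul_one (S : NC) : NC.mul S NC.one = S := by
  rw [NC.one_eq]
  exact congrArg coeff (_root_.mul_one (⟨S⟩ : Ser Letter))

theorem NC.smul_mul (a : ℂ) (S T : NC) : NC.mul (fun w => a * S w) T = fun w => a * NC.mul S T w := by
  funext w
  simp only [NC.mul, Finset.mul_sum, _root_.mul_assoc]

theorem NC.mul_smul (a : ℂ) (S T : NC) : NC.mul S (fun w => a * T w) = fun w => a * NC.mul S T w := by
  funext w
  simp only [NC.mul, Finset.mul_sum, mul_left_comm]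

/-- A series all of whose words have length `d`. -/
def IsHomog (d : ℕ) (S : NC) : Prop := ∀ w, w.length ≠ d → S w = 0

theorem IsHomog.mul {d e : ℕ} {S T : NC} (hS : IsHomog d S) (hT : IsHomog e T) :
    IsHomog (d + e) (NC.mul S T) := by
  intro w hw
  refine Finset.sum_eq_zero fun i hi => ?_
  have hi' : i ≤ w.length := by simpa [Nat.lt_succ_iff] using hi
  by_cases h : i = d
  · rw [hT, mul_zero]
    simp only [List.length_drop]
    omega
  · rw [hS, zero_mul]
    simpa [List.length_take, min_eq_left hi'] using h

theorem isHomog_x : IsHomog 1 NC.x := by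
  intro w hw
  rcases w with _ | ⟨_ | _, _ | ⟨b, w⟩⟩ <;> simp_all [NC.x]

theorem isHomog_adPow (n : ℕ) : IsHomog (n + 1) (adPow n) := by
  induction n with
  | zero =>
    intro w hw
    rcases w with _ | ⟨_ | _, _ | ⟨b, w⟩⟩ <;> simp_all [adPow, NC.y]
  | succ n ih =>
    intro w hw
    change NC.mul NC.x (adPow n) w - NC.mul (adPow n) NC.x w = 0
    rw [(isHomog_x.mul ih) w (by omega), (ih.mul isHomog_x) w (by omega), sub_zero]

/-- The degree of `ad^{n₁}(x)(y) ⋯ ad^{n_r}(x)(y)`. -/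
def deg (ns : List ℕ) : ℕ := ns.sum + ns.length

theorem isHomog_adMonomial (ns : List ℕ) : IsHomog (deg ns) (adMonomial ns) := by
  induction ns with
  | nil =>
    rintro (_ | ⟨a, w⟩) hw
    · simp [deg] at hw
    · rfl
  | cons n ns ih =>
    have := (isHomog_adPow n).mul ih
    rwa [show n + 1 + deg ns = deg (n :: ns) by simp [deg]; omega] at this

theorem adMonomial_append (u v : List ℕ) :
    adMonomial (u ++ v) = NC.mul (adMonomial u) (adMonomial v) := by
  induction u with
  | nil => exact (NC.one_mul _).symm
  | cons n u ih => rw [List.cons_append, adMonomial, ih, adMonomial, NC.mul_assoc]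

theorem adMonomial_singleton (n : ℕ) : adMonomial [n] = adPow n := NC.mul_one _

theorem finite_deg_le (N : ℕ) : {ns : List ℕ | deg ns ≤ N}.Finite := by
  refine ((List.finite_length_le (Fin (N + 1)) N).image (List.map Fin.val)).subset ?_
  intro ns hns
  have hns : ns.sum + ns.length ≤ N := hns
  refine ⟨ns.map (Fin.ofNat (N + 1)), ?_, ?_⟩
  · change (ns.map _).length ≤ N
    rw [List.length_map]; omega
  · rw [List.map_map]
    conv_rhs => rw [← List.map_id ns]
    refine List.map_congr_left fun n hn => ?_
    have := List.single_le_sum (by simp) n hn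
    simp only [Function.comp, Fin.ofNat, id]
    exact Nat.mod_eq_of_lt (by omega)

/-- The sequences of degree at most `N`. -/
def degLE (N : ℕ) : Finset (List ℕ) := (finite_deg_le N).toFinset

@[simp] theorem mem_degLE {N : ℕ} {ns : List ℕ} : ns ∈ degLE N ↔ deg ns ≤ N := by
  simp [degLE]

/-- The series `∑ c(n₁,…,n_r) ad^{n₁}(x)(y) ⋯ ad^{n_r}(x)(y)`. -/
def phi (c : Ser ℕ) : NC := fun w => ∑ᶠ ns : List ℕ, c ns * adMonomial ns w

theorem phi_eq_sum_of {c : Ser ℕ} {w : List Letter} (s : Finset (List ℕ))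
    (h : ∀ ns, c ns * adMonomial ns w ≠ 0 → ns ∈ s) :
    phi c w = ∑ ns ∈ s, c ns * adMonomial ns w :=
  finsum_eq_sum_of_support_subset _ fun ns hns => h ns hns

theorem adMonomial_ne_zero {ns : List ℕ} {w : List Letter} (h : adMonomial ns w ≠ 0) :
    w.length = deg ns := by
  by_contra h'
  exact h (isHomog_adMonomial ns w h')

theorem phi_eq_sum (c : Ser ℕ) {w : List Letter} {N : ℕ} (h : w.length ≤ N) :
    phi c w = ∑ ns ∈ degLE N, c ns * adMonomial ns w :=
  phi_eq_sum_of _ fun ns hns => by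
    rw [mem_degLE, ← adMonomial_ne_zero (right_ne_zero_of_mul hns)]
    exact h

theorem phi_sub (c d : Ser ℕ) (w : List Letter) : phi (c - d) w = phi c w - phi d w := by
  simp only [phi_eq_sum _ le_rfl, sub_apply, sub_mul, Finset.sum_sub_distrib]

theorem phi_one : phi 1 = NC.one := by
  funext w
  rw [phi_eq_sum_of {[]}]
  · simp [adMonomial]
  · rintro (_ | ⟨n, ns⟩) h
    · simp
    · simp at h

/-- Pairs of sequences correspond to one sequence with a cut, and `adMonomial` is multiplicative for
concatenation. -/
theorem phi_mul (c d : Ser ℕ) : NC.mul (phi c) (phi d) = phi (c * d) := by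
  funext w
  have h1 : NC.mul (phi c) (phi d) w = ∑ p ∈ degLE w.length ×ˢ degLE w.length,
      c p.1 * d p.2 * adMonomial (p.1 ++ p.2) w := by
    have : ∀ i ∈ Finset.range (w.length + 1), phi c (w.take i) * phi d (w.drop i) =
        ∑ p ∈ degLE w.length ×ˢ degLE w.length,
          c p.1 * d p.2 * (adMonomial p.1 (w.take i) * adMonomial p.2 (w.drop i)) := by
      intro i _
      rw [phi_eq_sum c (N := w.length) (by simp), phi_eq_sum d (N := w.length) (by simp),
        Finset.sum_mul_sum, Finset.sum_product]
      refine Finset.sum_congr rfl fun a _ => Finset.sum_congr rfl fun b _ => by ring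
    rw [NC.mul, Finset.sum_congr rfl this, Finset.sum_comm]
    refine Finset.sum_congr rfl fun p _ => ?_
    rw [← Finset.mul_sum, adMonomial_append]
    rfl
  have h2 : phi (c * d) w = ∑ q ∈ (degLE w.length).sigma fun ns => Finset.range (ns.length + 1),
      c (q.1.take q.2) * d (q.1.drop q.2) * adMonomial q.1 w := by
    rw [phi_eq_sum _ le_rfl, Finset.sum_sigma]
    refine Finset.sum_congr rfl fun ns _ => ?_
    rw [mul_apply, Finset.sum_mul]
  have deg_append : ∀ a b : List ℕ, deg (a ++ b) = deg a + deg b := fun a b => by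
    simp only [deg, List.sum_append, List.length_append]; omega
  -- Pairs of total degree above `|w|` contribute zero; discarding them makes concatenation a
  -- bijection between the two finite index sets.
  have h3 := Finset.sum_filter_of_ne (s := degLE w.length ×ˢ degLE w.length)
    (p := fun p => deg (p.1 ++ p.2) ≤ w.length)
    (f := fun p => c p.1 * d p.2 * adMonomial (p.1 ++ p.2) w)
    fun p _ hp => (adMonomial_ne_zero (right_ne_zero_of_mul hp)).ge
  rw [h1, h2, ← h3]
  refine Finset.sum_bij' (fun p _ => ⟨p.1 ++ p.2, p.1.length⟩) (fun q _ => (q.1.take q.2, q.1.drop q.2))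
    ?_ ?_ ?_ ?_ ?_
  · intro p hp
    simp only [Finset.mem_filter] at hp
    simp only [Finset.mem_sigma, mem_degLE, Finset.mem_range, List.length_append]
    exact ⟨hp.2, by omega⟩
  · rintro ⟨ns, i⟩ hq
    simp only [Finset.mem_sigma, mem_degLE, Finset.mem_range] at hq
    have := deg_append (ns.take i) (ns.drop i)
    rw [List.take_append_drop] at this
    simp only [Finset.mem_filter, Finset.mem_product, mem_degLE, List.take_append_drop]
    omega
  · intro p _
    simp
  · rintro ⟨ns, i⟩ hq
    simp only [Finset.mem_sigma, mem_degLE, Finset.mem_range] at hq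
    have : min i ns.length = i := min_eq_left (by omega)
    simp [this]
  · intro p _
    simp

theorem phi_letter (g : ℕ → ℂ) (w : List Letter) :
    phi (letter g) w = ∑ k ∈ Finset.range w.length, g k * adPow k w := by
  rw [phi_eq_sum_of ((Finset.range w.length).map ⟨fun k => [k], List.singleton_injective⟩),
    Finset.sum_map]
  · simp [adMonomial_singleton]
  · rintro (_ | ⟨n, _ | ⟨m, ns⟩⟩) h
    · simp at h
    · have := adMonomial_ne_zero (right_ne_zero_of_mul h)
      simp [deg] at this
      simp [this]
    · simp at h

theorem NC.pow_smul_adPow_one (l : ℂ) (n : ℕ) : NC.pow (fun w => l * adPow 1 w) n =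
    fun w => l ^ n * adMonomial (List.replicate n 1) w := by
  induction n with
  | zero => funext w; simp [NC.pow, adMonomial]
  | succ n ih =>
    rw [NC.pow, ih, NC.smul_mul, NC.mul_smul, List.replicate_succ', adMonomial_append,
      adMonomial_singleton]
    funext w
    ring

theorem phi_expSer (l : ℂ) : phi (expSer l) = NC.exp fun w => l * adPow 1 w := by
  funext w
  rw [phi_eq_sum_of ((Finset.range (w.length + 1)).map
    ⟨fun n => List.replicate n 1, List.replicate_left_injective 1⟩), Finset.sum_map]
  · refine Finset.sum_congr rfl fun n _ => ?_
    rw [NC.pow_smul_adPow_one]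
    have : ∀ m ∈ List.replicate n 1, m = 1 := fun m hm => List.eq_of_mem_replicate hm
    simp only [Function.Embedding.coeFn_mk, expSer, List.length_replicate, if_pos this]
    ring
  · intro ns h
    have h1 : ∀ n ∈ ns, n = 1 := by
      by_contra h'
      exact left_ne_zero_of_mul h (if_neg h')
    have h2 := adMonomial_ne_zero (right_ne_zero_of_mul h)
    simp only [deg] at h2
    simp only [Finset.mem_map, Finset.mem_range, Function.Embedding.coeFn_mk]
    exact ⟨ns.length, by omega, (List.eq_replicate_of_mem h1).symm⟩

/-! ### Uniqueness of the expansion -/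

theorem NC.x_eq : NC.x = (letter fun a => NC.x [a]).coeff := by
  funext w
  rcases w with _ | ⟨_ | _, _ | ⟨b, w⟩⟩ <;> rfl

theorem adPow_replicate_x (n : ℕ) : adPow n (List.replicate (n + 1) Letter.x) = 0 := by
  induction n with
  | zero => rfl
  | succ n ih =>
    change NC.mul NC.x (adPow n) _ - NC.mul (adPow n) NC.x _ = 0
    have h1 : NC.mul NC.x (adPow n) (List.replicate (n + 1 + 1) Letter.x) = 0 := by
      rw [List.replicate_succ, NC.x_eq, NC.mul_eq]
      refine (letter_mul_cons _ ⟨adPow n⟩ _ _).trans ?_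
      dsimp only
      rw [ih, mul_zero]
    have h2 : NC.mul (adPow n) NC.x (List.replicate (n + 1 + 1) Letter.x) = 0 := by
      rw [List.replicate_succ', NC.x_eq, NC.mul_eq]
      refine (mul_letter_concat _ ⟨adPow n⟩ _ _).trans ?_
      dsimp only
      rw [ih, zero_mul]
    rw [h1, h2, sub_zero]

/-- Only the leading term `x^n y` of the commutator produces this word. Together with the vanishing
at powers of `x` it gives the triangularity behind uniqueness. -/
theorem adPow_replicate_x_y (n : ℕ) :
    adPow n (List.replicate n Letter.x ++ [Letter.y]) = 1 := by
  induction n with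
  | zero => rfl
  | succ n ih =>
    change NC.mul NC.x (adPow n) _ - NC.mul (adPow n) NC.x _ = 1
    have h1 : NC.mul NC.x (adPow n) (List.replicate (n + 1) Letter.x ++ [Letter.y]) = 1 := by
      rw [List.replicate_succ, List.cons_append, NC.x_eq, NC.mul_eq]
      refine (letter_mul_cons _ ⟨adPow n⟩ _ _).trans ?_
      dsimp only
      rw [ih]
      exact mul_one _
    have h2 : NC.mul (adPow n) NC.x (List.replicate (n + 1) Letter.x ++ [Letter.y]) = 0 := by
      rw [NC.x_eq, NC.mul_eq]
      exact (mul_letter_concat _ ⟨adPow n⟩ _ _).trans (mul_zero _)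
    rw [h1, h2, sub_zero]

theorem phi_nil (c : Ser ℕ) : phi c [] = c [] := by
  rw [phi_eq_sum_of {[]}]
  · simp [adMonomial, NC.one]
  · intro ns h
    have := adMonomial_ne_zero (right_ne_zero_of_mul h)
    have h0 : ns.length = 0 := by
      simp only [deg, List.length_nil] at this
      omega
    simp [List.length_eq_zero_iff.1 h0]

/-- The first factors of an expansion. -/
theorem phi_eq_sum_shift (c : Ser ℕ) (w : List Letter) (hw : w ≠ []) :
    phi c w = ∑ n ∈ Finset.range w.length,
      adPow n (w.take (n + 1)) * phi (shift n c) (w.drop (n + 1)) := by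
  have hmul : ∀ n ∈ Finset.range w.length, ∀ ns, adMonomial (n :: ns) w =
      adPow n (w.take (n + 1)) * adMonomial ns (w.drop (n + 1)) := by
    intro n hn ns
    rw [Finset.mem_range] at hn
    rw [adMonomial, NC.mul, Finset.sum_eq_single (n + 1)]
    · intro i hi hin
      rw [isHomog_adPow n, zero_mul]
      rw [Finset.mem_range] at hi
      rw [List.length_take]
      omega
    · intro h
      simp at h
      omega
  have h1 : ∀ n ∈ Finset.range w.length,
      adPow n (w.take (n + 1)) * phi (shift n c) (w.drop (n + 1)) =
      ∑ ns ∈ degLE w.length, c (n :: ns) * adMonomial (n :: ns) w := by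
    intro n hn
    rw [phi_eq_sum (shift n c) (N := w.length) (by simp), Finset.mul_sum]
    refine Finset.sum_congr rfl fun ns _ => ?_
    rw [hmul n hn ns, shift_apply]
    ring
  rw [Finset.sum_congr rfl h1, ← Finset.sum_product' (f := fun n ns =>
    c (n :: ns) * adMonomial (n :: ns) w),
    phi_eq_sum_of ((Finset.range w.length ×ˢ degLE w.length).map
      ⟨fun p => p.1 :: p.2, fun p q h => by simpa [Prod.ext_iff] using h⟩), Finset.sum_map]
  · rfl
  · rintro (_ | ⟨n, ns⟩) h
    · exfalso
      apply right_ne_zero_of_mul h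
      rcases w with _ | ⟨a, w⟩
      · exact absurd rfl hw
      · rfl
    · have := adMonomial_ne_zero (right_ne_zero_of_mul h)
      simp only [deg, List.sum_cons, List.length_cons] at this
      simp only [Finset.mem_map, Finset.mem_product, Finset.mem_range, mem_degLE,
        deg]
      exact ⟨(n, ns), ⟨by omega, by simp only; omega⟩, rfl⟩

/-- Evaluate at the word `x^n y w`. A first factor `ad^m` with `m < n` meets a pure power of `x` and
gives zero, `m = n` gives the wanted coefficient, and `m > n` leaves a tail shorter than `w`,
covered by induction. Iterating over the letters shows that the `ad^n(x)(y)` are free. -/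
theorem phi_shift_eq_zero {c : Ser ℕ} (h : ∀ w, phi c w = 0) (n : ℕ) (w : List Letter) :
    phi (shift n c) w = 0 := by
  induction hl : w.length using Nat.strong_induction_on generalizing n w with
  | _ l ih =>
    have h0 := h (List.replicate n Letter.x ++ Letter.y :: w)
    rw [phi_eq_sum_shift c _ (by simp), Finset.sum_eq_single n] at h0
    · have e1 : (List.replicate n Letter.x ++ Letter.y :: w).take (n + 1) =
          List.replicate n Letter.x ++ [Letter.y] := by
        rw [List.take_append]; simp
      have e2 : (List.replicate n Letter.x ++ Letter.y :: w).drop (n + 1) = w := by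
        rw [List.drop_append]; simp
      rwa [e1, e2, adPow_replicate_x_y, one_mul] at h0
    · intro m hm hmn
      simp only [Finset.mem_range, List.length_append, List.length_replicate,
        List.length_cons] at hm
      rcases lt_or_gt_of_ne hmn with hlt | hgt
      · have e1 : (List.replicate n Letter.x ++ Letter.y :: w).take (m + 1) =
            List.replicate (m + 1) Letter.x := by
          rw [List.take_append_of_le_length (by simp; omega), List.take_replicate,
            min_eq_left (by omega)]
        rw [e1, adPow_replicate_x, zero_mul]
      · rw [ih _ _ m _ rfl, mul_zero]
        simp only [List.length_drop, List.length_append, List.length_replicate, List.length_cons]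
        omega
    · intro hn
      simp at hn

theorem eq_zero_of_phi_eq_zero {c : Ser ℕ} (h : ∀ w, phi c w = 0) (ns : List ℕ) : c ns = 0 := by
  induction ns generalizing c with
  | nil => rw [← phi_nil, h]
  | cons n ns ih => exact ih (c := shift n c) (phi_shift_eq_zero h n)

theorem phi_injective {c d : Ser ℕ} (h : phi c = phi d) : c = d := by
  refine sub_eq_zero.1 (Ser.ext fun ns => eq_zero_of_phi_eq_zero (fun w => ?_) ns)
  rw [phi_sub, h, sub_self]

theorem hasAdExpansion_iff {S : NC} {c : List ℕ → ℂ} : HasAdExpansion S c ↔ S = phi ⟨c⟩ :=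
  funext_iff.symm

theorem adCoeff_phi (c : Ser ℕ) : adCoeff (phi c) = c.coeff := by
  have h : ∃ d, HasAdExpansion (phi c) d := ⟨c.coeff, hasAdExpansion_iff.2 rfl⟩
  rw [adCoeff, dif_pos h]
  exact congrArg coeff (phi_injective (hasAdExpansion_iff.1 h.choose_spec)).symm

end EllMZV

namespace EllMZV

open Ser

/-! ### Iterated integrals -/

theorem intervalIntegrable_of_Ioo {h : ℝ → ℂ} (hh : ContinuousOn h (Set.Ioo 0 1)) {a b : ℝ}
    (ha : a ∈ Set.Ioo (0 : ℝ) 1) (hb : b ∈ Set.Ioo (0 : ℝ) 1) :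
    IntervalIntegrable h MeasureTheory.volume a b :=
  (hh.mono (Set.ordConnected_Ioo.uIcc_subset ha hb)).intervalIntegrable

theorem hasDerivAt_integral_upper {h : ℝ → ℂ} (hh : ContinuousOn h (Set.Ioo 0 1)) {a b : ℝ}
    (ha : a ∈ Set.Ioo (0 : ℝ) 1) (hb : b ∈ Set.Ioo (0 : ℝ) 1) :
    HasDerivAt (fun b => ∫ s in a..b, h s) (h b) b :=
  intervalIntegral.integral_hasDerivAt_right (intervalIntegrable_of_Ioo hh ha hb)
    (hh.stronglyMeasurableAtFilter isOpen_Ioo b hb) (hh.continuousAt (isOpen_Ioo.mem_nhds hb))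

theorem hasDerivAt_integral_lower {h : ℝ → ℂ} (hh : ContinuousOn h (Set.Ioo 0 1)) {a b : ℝ}
    (ha : a ∈ Set.Ioo (0 : ℝ) 1) (hb : b ∈ Set.Ioo (0 : ℝ) 1) :
    HasDerivAt (fun a => ∫ s in a..b, h s) (-h a) a :=
  intervalIntegral.integral_hasDerivAt_left (intervalIntegrable_of_Ioo hh ha hb)
    (hh.stronglyMeasurableAtFilter isOpen_Ioo a ha) (hh.continuousAt (isOpen_Ioo.mem_nhds ha))

/-- Iterated integrals as functions of the lower limit. -/
def lowInt (g : ℕ → ℝ → ℂ) (c : ℝ) : List ℕ → ℝ → ℂ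
  | [], _ => 1
  | n :: ns, t => ∫ s in t..c, g n s * lowInt g c ns s

/-- Iterated integrals as functions of the upper limit, for the reversed word. -/
def upInt (g : ℕ → ℝ → ℂ) (a : ℝ) : List ℕ → ℝ → ℂ
  | [], _ => 1
  | n :: ns, t => ∫ s in a..t, upInt g a ns s * g n s

/-- The generating series of iterated integrals, by recursion on the lower limit. -/
def lowSer (g : ℕ → ℝ → ℂ) (c t : ℝ) : Ser ℕ := ⟨fun ns => lowInt g c ns t⟩

/-- The generating series of iterated integrals, by recursion on the upper limit. -/
def upSer (g : ℕ → ℝ → ℂ) (a t : ℝ) : Ser ℕ := ⟨fun ns => upInt g a ns.reverse t⟩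

@[simp] theorem lowSer_nil (g : ℕ → ℝ → ℂ) (c t : ℝ) : lowSer g c t [] = 1 := rfl

@[simp] theorem upSer_nil (g : ℕ → ℝ → ℂ) (a t : ℝ) : upSer g a t [] = 1 := rfl

theorem upSer_concat (g : ℕ → ℝ → ℂ) (a t : ℝ) (ns : List ℕ) (n : ℕ) :
    upSer g a t (ns ++ [n]) = ∫ s in a..t, upSer g a s ns * g n s := by
  simp [upSer, upInt]

theorem lowSer_self (g : ℕ → ℝ → ℂ) (c : ℝ) : lowSer g c c = 1 := by
  ext w
  cases w
  · rfl
  · exact intervalIntegral.integral_same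

theorem upSer_self (g : ℕ → ℝ → ℂ) (a : ℝ) : upSer g a a = 1 := by
  ext w
  induction w using List.reverseRecOn with
  | nil => rfl
  | append_singleton w n _ =>
    rw [upSer_concat, intervalIntegral.integral_same]
    cases w <;> rfl

/-- The connection form `∑ g_n(t) n`. -/
def conn (g : ℕ → ℝ → ℂ) (t : ℝ) : Ser ℕ := letter fun n => g n t

section

variable {g : ℕ → ℝ → ℂ} (hg : ∀ n, ContinuousOn (g n) (Set.Ioo 0 1))
include hg

theorem hasDerivAt_lowSer {c t : ℝ} (hc : c ∈ Set.Ioo (0 : ℝ) 1) (ht : t ∈ Set.Ioo (0 : ℝ) 1)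
    (n : ℕ) (ns : List ℕ) :
    HasDerivAt (fun t => lowSer g c t (n :: ns)) (-g n t * lowSer g c t ns) t := by
  have hcont : ContinuousOn (lowInt g c ns) (Set.Ioo 0 1) := by
    induction ns with
    | nil => exact continuousOn_const
    | cons m ms ih =>
      exact fun s hs => (hasDerivAt_integral_lower ((hg m).mul ih) hs hc).continuousAt.continuousWithinAt
  rw [neg_mul]
  exact hasDerivAt_integral_lower ((hg n).mul hcont) ht hc

theorem hasD_lowSer {c t : ℝ} (hc : c ∈ Set.Ioo (0 : ℝ) 1) (ht : t ∈ Set.Ioo (0 : ℝ) 1) :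
    HasD (lowSer g c) (-(conn g t * lowSer g c t)) t := by
  rintro (_ | ⟨n, ns⟩)
  · simpa [conn] using hasDerivAt_const t (1 : ℂ)
  · rw [Ser.neg_apply, conn, letter_mul_cons, ← neg_mul]
    exact hasDerivAt_lowSer hg hc ht n ns

theorem continuousOn_upSer {a : ℝ} (ha : a ∈ Set.Ioo (0 : ℝ) 1) (ns : List ℕ) :
    ContinuousOn (fun t => upSer g a t ns) (Set.Ioo 0 1) := by
  induction ns using List.reverseRecOn with
  | nil => exact continuousOn_const
  | append_singleton ms m ih =>
    simp only [upSer_concat]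
    exact fun s hs =>
      (hasDerivAt_integral_upper (ih.mul (hg m)) ha hs).continuousAt.continuousWithinAt

theorem hasD_upSer {a t : ℝ} (ha : a ∈ Set.Ioo (0 : ℝ) 1) (ht : t ∈ Set.Ioo (0 : ℝ) 1) :
    HasD (upSer g a) (upSer g a t * conn g t) t := by
  intro ns
  induction ns using List.reverseRecOn with
  | nil => simpa [conn] using hasDerivAt_const t (1 : ℂ)
  | append_singleton ms m _ =>
    simp only [conn, mul_letter_concat, upSer_concat]
    exact hasDerivAt_integral_upper ((continuousOn_upSer hg ha ms).mul (hg m)) ha ht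

/-- The path from `t` to `c` followed by its inverse. If `Y` is the product, its derivative is the
commutator of `Y` with the connection; at a word this involves `Y` only at shorter words, where `Y =
1` by induction. -/
theorem lowSer_mul_upSer {c t : ℝ} (hc : c ∈ Set.Ioo (0 : ℝ) 1) (ht : t ∈ Set.Ioo (0 : ℝ) 1) :
    lowSer g c t * upSer g c t = 1 := by
  ext w
  induction hn : w.length using Nat.strong_induction_on generalizing w t with
  | _ n ih =>
    have hd : ∀ r ∈ Set.Ioo (0 : ℝ) 1, HasDerivAt (fun r => (lowSer g c r * upSer g c r) w) 0 r := by
      intro r hr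
      refine ((hasD_lowSer hg hc hr).mul (hasD_upSer hg hc hr) w).congr_deriv ?_
      rw [neg_mul, ← mul_assoc, mul_assoc (conn g r), add_apply, Ser.neg_apply]
      have h1 : (conn g r * (lowSer g c r * upSer g c r)) w = conn g r w := by
        rcases w with _ | ⟨m, ms⟩
        · simp [conn]
        · rw [conn, letter_mul_cons, ih ms.length (by simp at hn; omega) hr ms rfl,
            ← letter_mul_cons (fun n => g n r), mul_one]
      have h2 : (lowSer g c r * upSer g c r * conn g r) w = conn g r w := by
        rcases w.eq_nil_or_concat' with rfl | ⟨ms, m, rfl⟩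
        · simp [conn]
        · rw [conn, mul_letter_concat, ih ms.length (by simp at hn; omega) hr ms rfl,
            ← mul_letter_concat (fun n => g n r), one_mul]
      rw [h1, h2, neg_add_cancel]
    rw [eq_of_hasDerivAt_zero isOpen_Ioo isPreconnected_Ioo hd ht hc, lowSer_self, upSer_self,
      one_mul]

/-- Composition of paths through `c`. It separates the two limits of integration, which move
simultaneously in `preSer`. -/
theorem upSer_eq_lowSer_mul {a b c : ℝ} (ha : a ∈ Set.Ioo (0 : ℝ) 1) (hb : b ∈ Set.Ioo (0 : ℝ) 1)
    (hc : c ∈ Set.Ioo (0 : ℝ) 1) : upSer g a b = lowSer g c a * upSer g c b := by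
  ext w
  induction w using List.reverseRecOn generalizing b with
  | nil => rw [mul_nil]; simp [lowSer, lowInt]
  | append_singleton w m ih =>
    have hd : ∀ s ∈ Set.uIcc a b, HasDerivAt (fun s => (lowSer g c a * upSer g c s) (w ++ [m]))
        (upSer g a s w * g m s) s := by
      intro s hs
      have hs' := Set.ordConnected_Ioo.uIcc_subset ha hb hs
      have h0 : HasD (fun _ : ℝ => lowSer g c a) 0 s := fun _ => hasDerivAt_const _ _
      refine (h0.mul (hasD_upSer hg hc hs') (w ++ [m])).congr_deriv ?_
      rw [zero_mul, zero_add, ← mul_assoc, conn, mul_letter_concat, ih hs']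
    rw [upSer_concat, intervalIntegral.integral_eq_sub_of_hasDerivAt hd
      (intervalIntegrable_of_Ioo ((continuousOn_upSer hg ha w).mul (hg m)) ha hb),
      lowSer_mul_upSer hg hc ha]
    cases w <;> simp

/-- With the base point at the upper end the series is a `lowSer`, whose derivative strips the first
letter as `isChar_of_hasDerivAt` requires. -/
theorem isChar_upSer {a b : ℝ} (ha : a ∈ Set.Ioo (0 : ℝ) 1) (hb : b ∈ Set.Ioo (0 : ℝ) 1) :
    IsChar (upSer g a b) := by
  rw [upSer_eq_lowSer_mul hg ha hb hb, upSer_self, mul_one]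
  exact isChar_of_hasDerivAt isOpen_Ioo isPreconnected_Ioo (g := fun n t => -g n t)
    (fun _ _ => rfl) (fun t ht n ns => hasDerivAt_lowSer hg hb ht n ns) hb
    (by rw [lowSer_self]; exact isChar_one) ha

end

/-! ### The regularized series -/

/-- `log(-2πit)`. -/
def logT (t : ℝ) : ℂ := Complex.log (-2 * Real.pi * Complex.I * (t : ℂ))

/-- For `t > 0` the number `-2πit` lies on the negative imaginary axis, away from the branch cut. -/
theorem hasDerivAt_logT {t : ℝ} (ht : 0 < t) : HasDerivAt logT (1 / (t : ℂ)) t := by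
  have h0 : (t : ℂ) ≠ 0 := Complex.ofReal_ne_zero.2 ht.ne'
  have h1 : HasDerivAt (fun t : ℝ => -2 * Real.pi * Complex.I * (t : ℂ))
      (-2 * Real.pi * Complex.I) t := by
    simpa using (Complex.ofRealCLM.hasDerivAt (x := t)).const_mul (-2 * Real.pi * Complex.I)
  have h2 := h1.clog_real (Or.inr (by simp [Real.pi_ne_zero, ht.ne']))
  refine h2.congr_deriv ?_
  have := Complex.two_pi_I_ne_zero
  have h3 : (-2 * Real.pi * Complex.I : ℂ) ≠ 0 := by
    rw [neg_mul, neg_mul]; exact neg_ne_zero.2 this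
  rw [div_mul_eq_div_div, div_self h3]

/-- The coefficients of `(-2πit)^{ad(x)(y)} exp[∫_t^{1-t} J] (-2πit)^{-ad(x)(y)}`. -/
def preSer (g : ℕ → ℝ → ℂ) (t : ℝ) : Ser ℕ :=
  expSer (logT t) * upSer g t (1 - t) * expSer (-logT t)

/-- The coefficient on the left of the differential equation of `preSer`. -/
def leftConn (g : ℕ → ℝ → ℂ) (t : ℝ) : Ser ℕ :=
  expSer (logT t) * letter (fun n => atOne (1 / (t : ℂ)) n - g n t) * expSer (-logT t)

/-- The coefficient on the right of the differential equation of `preSer`. -/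
def rightConn (g : ℕ → ℝ → ℂ) (t : ℝ) : Ser ℕ :=
  expSer (logT t) * letter (fun n => -(atOne (1 / (t : ℂ)) n + g n (1 - t))) * expSer (-logT t)

theorem preSer_half (g : ℕ → ℝ → ℂ) : preSer g (1 / 2) = 1 := by
  rw [preSer, show (1 : ℝ) - 1 / 2 = 1 / 2 by norm_num, upSer_self, mul_one]
  simpa using expSer_neg_mul (-logT (1 / 2))

theorem hasD_congr {α : Type} {F G : ℝ → Ser α} {F' : Ser α} {s : Set ℝ} (hs : IsOpen s) {t : ℝ}
    (ht : t ∈ s) (h : ∀ r ∈ s, F r = G r) (hG : HasD G F' t) : HasD F F' t := fun w =>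
  (hG w).congr_of_eventuallyEq (eventually_of_mem (hs.mem_nhds ht) fun r hr => by simp only [h r hr])

/-- Write the series as `P L U Q` with `P' = PA`, `L' = -BL`, `U' = -UC`, `Q' = -AQ`. Inserting `QP
= 1` collects the derivative into `P(A - B)Q` on the left and `-P(A + C)Q` on the right, so the pole
`A` cancels those of the connection at both ends. -/
theorem hasD_preSer {g : ℕ → ℝ → ℂ} (hg : ∀ n, ContinuousOn (g n) (Set.Ioo 0 1)) {t : ℝ}
    (ht : t ∈ Set.Ioo (0 : ℝ) 1) :
    HasD (preSer g) (leftConn g t * preSer g t + preSer g t * rightConn g t) t := by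
  have hc : (1 / 2 : ℝ) ∈ Set.Ioo (0 : ℝ) 1 := by norm_num
  have hsymm : ∀ r ∈ Set.Ioo (0 : ℝ) 1, 1 - r ∈ Set.Ioo (0 : ℝ) 1 := fun r hr =>
    ⟨by linarith [hr.2], by linarith [hr.1]⟩
  have hφ : HasDerivAt (fun r : ℝ => 1 - r) (-1) t := by
    simpa using (hasDerivAt_id t).const_sub 1
  have hE := hasD_congr isOpen_Ioo ht
    (fun r hr => upSer_eq_lowSer_mul hg hr (hsymm r hr) hc)
    ((hasD_lowSer hg hc ht).mul ((hasD_upSer hg hc (hsymm t ht)).scomp hφ))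
  have hl := hasDerivAt_logT ht.1
  have hX := ((hasD_expSer_right hl).mul hE).mul (hasD_expSer_left hl.neg)
  intro w
  refine (hX w).congr_deriv (congrArg (fun S : Ser ℕ => S w) ?_)
  have hQP : expSer (-logT t) * expSer (logT t) = 1 := expSer_neg_mul _
  have hL : letter (fun n => atOne (1 / (t : ℂ)) n - g n t) =
      letter (atOne (1 / (t : ℂ))) - conn g t := by rw [conn, sub_letter]; rfl
  have hR : letter (fun n => -(atOne (1 / (t : ℂ)) n + g n (1 - t))) =
      -(letter (atOne (1 / (t : ℂ))) + conn g (1 - t)) := by rw [conn, add_letter, neg_letter]; rfl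
  have hs : ∀ S : Ser ℕ, ((-1 : ℝ) : ℂ) • S = -S := fun S => by simp
  rw [preSer, leftConn, rightConn, hL, hR, upSer_eq_lowSer_mul hg ht (hsymm t ht) hc, hs,
    atOne_neg, ← neg_letter]
  generalize letter (atOne (1 / (t : ℂ))) = A
  simp only [Pi.neg_apply]
  generalize expSer (-logT t) = Q at *
  generalize expSer (logT t) = P at *
  generalize lowSer g (1 / 2) t = L
  generalize upSer g (1 / 2) (1 - t) = U
  generalize conn g t = B
  generalize conn g (1 - t) = C
  have e1 : P * (A - B) * Q * (P * (L * U) * Q) = P * (A - B) * (Q * P) * (L * U) * Q := by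
    simp only [mul_assoc]
  have e2 : P * (L * U) * Q * (P * -(A + C) * Q) = P * (L * U) * (Q * P) * -(A + C) * Q := by
    simp only [mul_assoc]
  rw [e1, e2, hQP]
  noncomm_ring

theorem preSer_nil (g : ℕ → ℝ → ℂ) (t : ℝ) : preSer g t [] = 1 := by
  simp [preSer]

theorem isChar_preSer {g : ℕ → ℝ → ℂ} (hg : ∀ n, ContinuousOn (g n) (Set.Ioo 0 1)) {t : ℝ}
    (ht : t ∈ Set.Ioo (0 : ℝ) 1) : IsChar (preSer g t) :=
  ((isChar_expSer _).mul (isChar_upSer hg ht ⟨by linarith [ht.2], by linarith [ht.1]⟩)).mul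
    (isChar_expSer _)

/-! ### The series of the statement -/

/-- The part of a series of length `k`. -/
def lengthPart (k : ℕ) (c : Ser ℕ) : Ser ℕ := ⟨fun ns => if ns.length = k then c ns else 0⟩

theorem connection_eq (τ : ℍ) (s : ℝ) :
    connection τ s = phi (conn (fun n s => f τ n s) s) := by
  funext w
  rw [conn, phi_letter]
  rfl

/-- Each integration appends one letter, so the `k`-fold integral is the part of length `k`. At a
fixed word the expansion is a finite sum, and integration passes to the coefficients. -/
theorem iterInt_eq {τ : ℍ} (hg : ∀ n, ContinuousOn (fun s : ℝ => f τ n s) (Set.Ioo 0 1)) {a b : ℝ}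
    (ha : a ∈ Set.Ioo (0 : ℝ) 1) (hb : b ∈ Set.Ioo (0 : ℝ) 1) (k : ℕ) :
    iterInt τ a k b = phi (lengthPart k (upSer (fun n s => f τ n s) a b)) := by
  induction k generalizing b with
  | zero =>
    have : lengthPart 0 (upSer (fun n (s : ℝ) => f τ n s) a b) = 1 := by
      ext w
      cases w
      · rfl
      · simp [lengthPart]
    rw [this, phi_one]
    rfl
  | succ k ih =>
    funext w
    have hsub := Set.ordConnected_Ioo.uIcc_subset ha hb
    have h1 : iterInt τ a (k + 1) b w = ∫ s in a..b, ∑ ns ∈ degLE w.length,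
        (lengthPart k (upSer (fun n s => f τ n s) a s) * conn (fun n s => f τ n s) s) ns *
          adMonomial ns w := by
      refine intervalIntegral.integral_congr fun s hs => ?_
      simp only [ih (hsub hs), connection_eq, phi_mul]
      exact phi_eq_sum _ le_rfl
    have hpt : ∀ ns, (∀ b ∈ Set.Ioo (0 : ℝ) 1, lengthPart (k + 1) (upSer (fun n s => f τ n s) a b) ns =
          ∫ s in a..b, (lengthPart k (upSer (fun n s => f τ n s) a s) *
            conn (fun n s => f τ n s) s) ns) ∧
        ContinuousOn (fun s => (lengthPart k (upSer (fun n s => f τ n s) a s) *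
            conn (fun n s => f τ n s) s) ns) (Set.Ioo 0 1) := by
      intro ns
      rcases ns.eq_nil_or_concat' with rfl | ⟨ms, m, rfl⟩
      · simp [conn, lengthPart]
        exact continuousOn_const
      · simp only [conn, mul_letter_concat]
        by_cases hk : ms.length = k
        · simp only [lengthPart, List.length_append, List.length_singleton, hk, if_true,
            upSer_concat, implies_true, true_and]
          exact (continuousOn_upSer hg ha ms).mul (hg m)
        · simp [lengthPart, hk]
          exact continuousOn_const
    rw [h1, intervalIntegral.integral_finsetSum fun ns _ =>
      (intervalIntegrable_of_Ioo (hpt ns).2 ha hb).mul_const _, phi_eq_sum _ le_rfl]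
    refine Finset.sum_congr rfl fun ns _ => ?_
    rw [intervalIntegral.integral_mul_const, (hpt ns).1 b hb]

theorem pathExp_eq {τ : ℍ} (hg : ∀ n, ContinuousOn (fun s : ℝ => f τ n s) (Set.Ioo 0 1)) {a b : ℝ}
    (ha : a ∈ Set.Ioo (0 : ℝ) 1) (hb : b ∈ Set.Ioo (0 : ℝ) 1) :
    pathExp τ a b = phi (upSer (fun n s => f τ n s) a b) := by
  funext w
  simp only [pathExp, iterInt_eq hg ha hb, phi_eq_sum _ le_rfl]
  rw [Finset.sum_comm]
  refine Finset.sum_congr rfl fun ns hns => ?_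
  -- The degree is at least the length, so truncating at `k ≤ |w|` loses nothing.
  rw [mem_degLE, deg] at hns
  rw [← Finset.sum_mul, Finset.sum_eq_single ns.length]
  · simp [lengthPart]
  · intro k _ hk
    exact if_neg (Ne.symm hk)
  · intro h
    simp at h
    omega

theorem preSeries_eq {τ : ℍ} (hg : ∀ n, ContinuousOn (fun s : ℝ => f τ n s) (Set.Ioo 0 1)) {t : ℝ}
    (ht : t ∈ Set.Ioo (0 : ℝ) 1) :
    preSeries τ t = phi (preSer (fun n s => f τ n s) t) := by
  have h : ∀ ε : ℂ, tPow t ε = phi (expSer (ε * logT t)) := fun ε => by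
    rw [phi_expSer]; rfl
  rw [preSeries, h, h, pathExp_eq hg ht ⟨by linarith [ht.2], by linarith [ht.1]⟩, phi_mul, phi_mul,
    one_mul, neg_one_mul]
  rfl

end EllMZV

namespace EllMZV

open Ser MeasureTheory

/-! ### Functions of moderate growth at zero -/

/-- Functions on `U × (0, 1/2]` that are holomorphic in the first variable, continuous in the
second, and grow more slowly than any negative power of the second variable. -/
structure Moderate (U : Set ℂ) (h : ℂ → ℝ → ℂ) : Prop where
  cont : ∀ z ∈ U, ContinuousOn (h z) (Set.Ioc 0 (1 / 2))
  holo : ∀ s ∈ Set.Ioc (0 : ℝ) (1 / 2), DifferentiableOn ℂ (fun z => h z s) U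
  bdd : ∀ z₀ ∈ U, ∀ ε : ℝ, 0 < ε → ∃ C, ∀ᶠ z in 𝓝 z₀, ∀ s ∈ Set.Ioc (0 : ℝ) (1 / 2),
    ‖h z s‖ ≤ C * s ^ (-ε)

theorem one_le_rpow_neg {s ε : ℝ} (hs : s ∈ Set.Ioc (0 : ℝ) (1 / 2)) (hε : 0 < ε) :
    1 ≤ s ^ (-ε) :=
  Real.one_le_rpow_of_pos_of_le_one_of_nonpos hs.1 (by linarith [hs.2]) (by linarith)

namespace Moderate

variable {U : Set ℂ} {h h' : ℂ → ℝ → ℂ}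

theorem of_bounded (hc : ∀ z ∈ U, ContinuousOn (h z) (Set.Ioc 0 (1 / 2)))
    (hh : ∀ s ∈ Set.Ioc (0 : ℝ) (1 / 2), DifferentiableOn ℂ (fun z => h z s) U)
    (hb : ∀ z₀ ∈ U, ∃ C, ∀ᶠ z in 𝓝 z₀, ∀ s ∈ Set.Ioc (0 : ℝ) (1 / 2), ‖h z s‖ ≤ C) :
    Moderate U h where
  cont := hc
  holo := hh
  bdd z₀ hz₀ ε hε := by
    obtain ⟨C, hC⟩ := hb z₀ hz₀
    refine ⟨|C|, hC.mono fun z hz s hs => (hz s hs).trans ((le_abs_self C).trans ?_)⟩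
    exact le_mul_of_one_le_right (abs_nonneg C) (one_le_rpow_neg hs hε)

theorem const (U : Set ℂ) (c : ℂ) : Moderate U fun _ _ => c :=
  of_bounded (fun _ _ => continuousOn_const) (fun _ _ => differentiableOn_const c)
    fun _ _ => ⟨‖c‖, Eventually.of_forall fun _ _ _ => le_rfl⟩

theorem add (hh : Moderate U h) (hh' : Moderate U h') : Moderate U fun z s => h z s + h' z s where
  cont z hz := (hh.cont z hz).add (hh'.cont z hz)
  holo s hs := (hh.holo s hs).add (hh'.holo s hs)
  bdd z₀ hz₀ ε hε := by
    obtain ⟨C, hC⟩ := hh.bdd z₀ hz₀ ε hε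
    obtain ⟨C', hC'⟩ := hh'.bdd z₀ hz₀ ε hε
    refine ⟨C + C', (hC.and hC').mono fun z hz s hs => ?_⟩
    rw [add_mul]
    exact (norm_add_le _ _).trans (add_le_add (hz.1 s hs) (hz.2 s hs))

/-- Bounds for every `ε` make the class closed under products: each factor takes `ε / 2`. -/
theorem mul (hh : Moderate U h) (hh' : Moderate U h') : Moderate U fun z s => h z s * h' z s where
  cont z hz := (hh.cont z hz).mul (hh'.cont z hz)
  holo s hs := (hh.holo s hs).mul (hh'.holo s hs)
  bdd z₀ hz₀ ε hε := by
    obtain ⟨C, hC⟩ := hh.bdd z₀ hz₀ (ε / 2) (half_pos hε)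
    obtain ⟨C', hC'⟩ := hh'.bdd z₀ hz₀ (ε / 2) (half_pos hε)
    refine ⟨C * C', (hC.and hC').mono fun z hz s hs => ?_⟩
    have e : s ^ (-ε) = s ^ (-(ε / 2)) * s ^ (-(ε / 2)) := by
      rw [← Real.rpow_add hs.1]; congr 1; ring
    rw [norm_mul, e, mul_mul_mul_comm]
    exact mul_le_mul (hz.1 s hs) (hz.2 s hs) (norm_nonneg _) ((norm_nonneg _).trans (hz.1 s hs))

theorem neg (hh : Moderate U h) : Moderate U fun z s => -h z s := by
  simpa using (const U (-1)).mul hh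

theorem pow (hh : Moderate U h) (n : ℕ) : Moderate U fun z s => h z s ^ n := by
  induction n with
  | zero => simpa using const U 1
  | succ n ih => simpa only [pow_succ] using ih.mul hh

theorem sum {ι : Type} {t : Finset ι} {k : ι → ℂ → ℝ → ℂ} (hk : ∀ i ∈ t, Moderate U (k i)) :
    Moderate U fun z s => ∑ i ∈ t, k i z s := by
  classical
  induction t using Finset.induction_on with
  | empty => simpa using const U 0
  | insert i t hi ih =>
    simp only [Finset.sum_insert hi]
    exact (hk i (Finset.mem_insert_self i t)).add (ih fun j hj => hk j (Finset.mem_insert_of_mem hj))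

theorem congr (hU : IsOpen U) (hh : Moderate U h)
    (e : ∀ z ∈ U, ∀ s ∈ Set.Ioc (0 : ℝ) (1 / 2), h' z s = h z s) : Moderate U h' where
  cont z hz := (hh.cont z hz).congr fun s hs => e z hz s hs
  holo s hs := (hh.holo s hs).congr fun z hz => e z hz s hs
  bdd z₀ hz₀ ε hε := by
    obtain ⟨C, hC⟩ := hh.bdd z₀ hz₀ ε hε
    refine ⟨C, (hC.and (hU.mem_nhds hz₀)).mono fun z hz s hs => ?_⟩
    rw [e z hz.2 s hs]
    exact hz.1 s hs

/-- The exponent `1/2` is one choice of `ε` in `(0, 1)`; it serves as the dominating function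
throughout. -/
theorem integrableOn_bound (C : ℝ) :
    IntegrableOn (fun s : ℝ => C * s ^ (-(1 / 2 : ℝ))) (Set.Ioc 0 (1 / 2)) :=
  ((intervalIntegrable_iff_integrableOn_Ioc_of_le (by norm_num)).1
    (intervalIntegral.intervalIntegrable_rpow' (by norm_num))).const_mul C

theorem integrableOn (hh : Moderate U h) {z : ℂ} (hz : z ∈ U) :
    IntegrableOn (h z) (Set.Ioc 0 (1 / 2)) := by
  obtain ⟨C, hC⟩ := hh.bdd z hz (1 / 2) (by norm_num)
  refine (integrableOn_bound C).mono' ((hh.cont z hz).aestronglyMeasurable measurableSet_Ioc) ?_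
  exact (ae_restrict_iff' measurableSet_Ioc).2
    (Eventually.of_forall fun s hs => hC.self_of_nhds s hs)

theorem differentiableOn_integral (hU : IsOpen U) (hh : Moderate U h) {t : ℝ} (ht : 0 ≤ t)
    (ht' : t ≤ 1 / 2) : DifferentiableOn ℂ (fun z => ∫ s in t..(1 / 2), h z s) U := by
  have hsub : Set.Ioc t (1 / 2) ⊆ Set.Ioc 0 (1 / 2) := Set.Ioc_subset_Ioc_left ht
  simp only [intervalIntegral.integral_of_le ht']
  refine EllMZV.differentiableOn_integral hU
    (fun z hz => ((hh.integrableOn hz).mono_set hsub).aestronglyMeasurable)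
    ((ae_restrict_iff' measurableSet_Ioc).2 (Eventually.of_forall fun s hs => hh.holo s (hsub hs)))
    fun z₀ hz₀ => ?_
  obtain ⟨C, hC⟩ := hh.bdd z₀ hz₀ (1 / 2) (by norm_num)
  exact ⟨_, hC, _, (integrableOn_bound C).mono_set hsub,
    (ae_restrict_iff' measurableSet_Ioc).2 (Eventually.of_forall fun s hs z hz => hz s (hsub hs))⟩

theorem continuousOn_integral (hh : Moderate U h) {z : ℂ} (hz : z ∈ U) :
    ContinuousOn (fun t => ∫ s in t..(1 / 2), h z s) (Set.Icc 0 (1 / 2)) := by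
  have := intervalIntegral.continuousOn_primitive_interval_left (f := h z) (a := 0) (b := 1 / 2)
    (μ := volume) (by
      rw [Set.uIcc_of_le (by norm_num), integrableOn_Icc_iff_integrableOn_Ioc]
      exact hh.integrableOn hz)
  rwa [Set.uIcc_of_le (by norm_num)] at this

theorem tendsto_integral (hh : Moderate U h) {z : ℂ} (hz : z ∈ U) :
    Tendsto (fun t => ∫ s in t..(1 / 2), h z s) (𝓝[>] 0) (𝓝 (∫ s in 0..(1 / 2), h z s)) := by
  have h1 := (hh.continuousOn_integral hz) 0 (by norm_num)
  refine h1.mono_left ?_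
  rw [← nhdsWithin_Ioc_eq_nhdsGT (by norm_num : (0 : ℝ) < 1 / 2)]
  exact nhdsWithin_mono _ Set.Ioc_subset_Icc_self

theorem integral (hU : IsOpen U) (hh : Moderate U h) :
    Moderate U fun z t => ∫ s in t..(1 / 2), h z s := by
  refine of_bounded (fun z hz => (hh.continuousOn_integral hz).mono Set.Ioc_subset_Icc_self)
    (fun t ht => hh.differentiableOn_integral hU ht.1.le ht.2) fun z₀ hz₀ => ?_
  obtain ⟨C, hC⟩ := hh.bdd z₀ hz₀ (1 / 2) (by norm_num)
  refine ⟨∫ s in Set.Ioc (0 : ℝ) (1 / 2), C * s ^ (-(1 / 2 : ℝ)), hC.mono fun z hz t ht => ?_⟩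
  have hsub : Set.Ioc t (1 / 2) ⊆ Set.Ioc 0 (1 / 2) := Set.Ioc_subset_Ioc_left ht.1.le
  rw [intervalIntegral.integral_of_le ht.2]
  refine (norm_integral_le_of_norm_le ((integrableOn_bound C).mono_set hsub)
    ((ae_restrict_iff' measurableSet_Ioc).2
      (Eventually.of_forall fun s hs => hz s (hsub hs)))).trans ?_
  refine setIntegral_mono_set (integrableOn_bound C) ?_ hsub.eventuallyLE
  exact (ae_restrict_iff' measurableSet_Ioc).2
    (Eventually.of_forall fun s hs => (norm_nonneg _).trans (hz s hs))

end Moderate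

theorem moderate_logT (U : Set ℂ) : Moderate U fun _ s => logT s where
  cont _ _ s hs := (hasDerivAt_logT hs.1).continuousAt.continuousWithinAt
  holo _ _ := differentiableOn_const _
  bdd _ _ ε hε := by
    -- The summands bound `log 2π`, the argument, and `log s` through `|log s| ≤ s^(-ε) / ε`.
    refine ⟨|Real.log (2 * Real.pi)| + Real.pi + 1 / ε, Eventually.of_forall fun _ s hs => ?_⟩
    have h1 := one_le_rpow_neg hs hε
    have h2 : |Real.log s| ≤ 1 / ε * s ^ (-ε) := by
      have h3 := (Real.abs_log_mul_self_rpow_lt s ε hs.1 (by linarith [hs.2]) hε).le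
      have h4 : 0 < s ^ ε := Real.rpow_pos_of_pos hs.1 ε
      rw [abs_mul, abs_of_pos h4] at h3
      rw [Real.rpow_neg hs.1.le, ← div_eq_mul_inv, le_div_iff₀ h4]
      exact h3
    have h5 : |(logT s).re| ≤ |Real.log (2 * Real.pi)| + |Real.log s| := by
      have : ‖(-2 * Real.pi * Complex.I * (s : ℂ))‖ = 2 * Real.pi * s := by
        simp [abs_of_pos Real.pi_pos, abs_of_pos hs.1]
      rw [logT, Complex.log_re, this, Real.log_mul (by positivity) hs.1.ne']
      exact abs_add_le _ _
    have h6 : |(logT s).im| ≤ Real.pi := by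
      rw [logT, Complex.log_im]
      exact Complex.abs_arg_le_pi _
    have h7 : |Real.log (2 * Real.pi)| + Real.pi ≤
        (|Real.log (2 * Real.pi)| + Real.pi) * s ^ (-ε) :=
      le_mul_of_one_le_right (add_nonneg (abs_nonneg _) Real.pi_pos.le) h1
    calc ‖logT s‖ ≤ |(logT s).re| + |(logT s).im| := Complex.norm_le_abs_re_add_abs_im _
      _ ≤ _ := by rw [add_mul]; linarith

theorem Moderate.expSer {U : Set ℂ} {l : ℂ → ℝ → ℂ} (hl : Moderate U l) (w : List ℕ) :
    Moderate U fun z s => expSer (l z s) w := by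
  by_cases h : ∀ n ∈ w, n = 1
  · simp only [EllMZV.expSer, if_pos h, div_eq_mul_inv]
    exact (hl.pow _).mul (Moderate.const U _)
  · simp only [EllMZV.expSer, if_neg h]
    exact Moderate.const U 0

theorem Moderate.ser_mul {U : Set ℂ} {F G : ℂ → ℝ → Ser ℕ}
    (hF : ∀ w, Moderate U fun z s => F z s w) (hG : ∀ w, Moderate U fun z s => G z s w)
    (w : List ℕ) : Moderate U fun z s => (F z s * G z s) w := by
  simp only [mul_apply]
  exact Moderate.sum fun i _ => (hF _).mul (hG _)

theorem Moderate.letter {U : Set ℂ} {a : ℂ → ℝ → ℕ → ℂ}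
    (ha : ∀ n, Moderate U fun z s => a z s n) (w : List ℕ) :
    Moderate U fun z s => letter (a z s) w := by
  rcases w with _ | ⟨n, _ | ⟨m, w⟩⟩
  · exact Moderate.const U 0
  · exact ha n
  · exact Moderate.const U 0

/-! ### Fuchsian families and their regularized limits -/

/-- Families of connections on `(0, 1)`, depending holomorphically on a parameter, whose only
poles at the ends are those of the first coefficient, simple and of residue one. -/
structure FuchsianFamily (U : Set ℂ) (g : ℂ → ℕ → ℝ → ℂ) : Prop where
  cont : ∀ z ∈ U, ∀ n, ContinuousOn (g z n) (Set.Ioo 0 1)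
  holo : ∀ n, ∀ s ∈ Set.Ioo (0 : ℝ) 1, DifferentiableOn ℂ (fun z => g z n s) U
  bdd_left : ∀ z₀ ∈ U, ∀ n, ∃ C, ∀ᶠ z in 𝓝 z₀, ∀ s ∈ Set.Ioc (0 : ℝ) (1 / 2),
    ‖g z n s - atOne (1 / (s : ℂ)) n‖ ≤ C
  bdd_right : ∀ z₀ ∈ U, ∀ n, ∃ C, ∀ᶠ z in 𝓝 z₀, ∀ s ∈ Set.Ioc (0 : ℝ) (1 / 2),
    ‖g z n (1 - s) + atOne (1 / (s : ℂ)) n‖ ≤ C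

namespace FuchsianFamily

variable {U : Set ℂ} {g : ℂ → ℕ → ℝ → ℂ}

theorem continuousOn_atOne (n : ℕ) :
    ContinuousOn (fun s : ℝ => atOne (1 / (s : ℂ)) n) (Set.Ioc 0 (1 / 2)) := by
  unfold atOne
  split_ifs
  · exact continuousOn_const.div Complex.continuous_ofReal.continuousOn
      fun s hs => Complex.ofReal_ne_zero.2 hs.1.ne'
  · exact continuousOn_const

/-- The derivative of the logarithm cancels the pole of the connection, leaving a bounded letter
coefficient; conjugation by the exponential multiplies it only by powers of `log`. -/
theorem moderate_leftConn (hg : FuchsianFamily U g) (w : List ℕ) :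
    Moderate U fun z s => leftConn (g z) s w := by
  refine Moderate.ser_mul (Moderate.ser_mul (moderate_logT U).expSer (Moderate.letter fun n => ?_))
    (moderate_logT U).neg.expSer w
  have hI : Set.Ioc (0 : ℝ) (1 / 2) ⊆ Set.Ioo 0 1 := fun s hs => ⟨hs.1, by linarith [hs.2]⟩
  refine Moderate.of_bounded (fun z hz => (continuousOn_atOne n).sub ((hg.cont z hz n).mono hI))
    (fun s hs => (differentiableOn_const _).sub (hg.holo n s (hI hs))) fun z₀ hz₀ => ?_
  obtain ⟨C, hC⟩ := hg.bdd_left z₀ hz₀ n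
  exact ⟨C, hC.mono fun z hz s hs => by rw [norm_sub_rev]; exact hz s hs⟩

theorem moderate_rightConn (hg : FuchsianFamily U g) (w : List ℕ) :
    Moderate U fun z s => rightConn (g z) s w := by
  refine Moderate.ser_mul (Moderate.ser_mul (moderate_logT U).expSer (Moderate.letter fun n => ?_))
    (moderate_logT U).neg.expSer w
  have hI : ∀ s ∈ Set.Ioc (0 : ℝ) (1 / 2), 1 - s ∈ Set.Ioo (0 : ℝ) 1 := fun s hs =>
    ⟨by linarith [hs.2], by linarith [hs.1]⟩
  refine Moderate.neg (Moderate.of_bounded (fun z hz => (continuousOn_atOne n).add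
    ((hg.cont z hz n).comp (by fun_prop) hI))
    (fun s hs => (differentiableOn_const _).add (hg.holo n _ (hI s hs))) fun z₀ hz₀ => ?_)
  obtain ⟨C, hC⟩ := hg.bdd_right z₀ hz₀ n
  exact ⟨C, hC.mono fun z hz s hs => by rw [add_comm]; exact hz s hs⟩

theorem leftConn_nil (g : ℕ → ℝ → ℂ) (t : ℝ) : leftConn g t [] = 0 := by simp [leftConn]

theorem rightConn_nil (g : ℕ → ℝ → ℂ) (t : ℝ) : rightConn g t [] = 0 := by simp [rightConn]

/-- The derivative of `preSer` has moderate growth, if its coefficients at shorter words have. -/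
theorem moderate_deriv (hg : FuchsianFamily U g) {w : List ℕ}
    (h : ∀ v : List ℕ, v.length < w.length → Moderate U fun z s => preSer (g z) s v) :
    Moderate U fun z s => (leftConn (g z) s * preSer (g z) s + preSer (g z) s * rightConn (g z) s) w := by
  simp only [Ser.add_apply, Ser.mul_apply]
  refine (Moderate.sum fun i hi => ?_).add (Moderate.sum fun i hi => ?_)
  · rw [Finset.mem_range] at hi
    -- The only term containing `preSer` at `w` itself is killed by the vanishing constant term of
    -- `leftConn`; below, `rightConn` plays the same role.
    rcases Nat.eq_zero_or_pos i with rfl | hpos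
    · simpa [leftConn_nil] using Moderate.const U 0
    · exact (hg.moderate_leftConn _).mul (h _ (by rw [List.length_drop]; omega))
  · rw [Finset.mem_range] at hi
    rcases Nat.lt_or_ge i w.length with hlt | hge
    · exact (h _ (by rw [List.length_take]; omega)).mul (hg.moderate_rightConn _)
    · simpa [List.drop_eq_nil_of_le hge, rightConn_nil] using Moderate.const U 0

/-- The base point is `t = 1/2`, where the path degenerates to a point and the two exponentials
cancel, so the initial value is `1`. -/
theorem preSer_eq_integral (hg : FuchsianFamily U g) {w : List ℕ}
    (h : ∀ v : List ℕ, v.length < w.length → Moderate U fun z s => preSer (g z) s v) {z : ℂ}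
    (hz : z ∈ U) {t : ℝ} (ht : t ∈ Set.Ioc (0 : ℝ) (1 / 2)) :
    preSer (g z) t w = (1 : Ser ℕ) w + -∫ s in t..(1 / 2),
      (leftConn (g z) s * preSer (g z) s + preSer (g z) s * rightConn (g z) s) w := by
  have hsub : Set.uIcc t (1 / 2) ⊆ Set.Ioc 0 (1 / 2) := by
    rw [Set.uIcc_of_le ht.2]
    exact fun s hs => ⟨ht.1.trans_le hs.1, hs.2⟩
  rw [intervalIntegral.integral_eq_sub_of_hasDerivAt
    (f := fun s => preSer (g z) s w)
    (fun s hs => hasD_preSer (hg.cont z hz) ⟨(hsub hs).1, by linarith [(hsub hs).2]⟩ w)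
    (((hg.moderate_deriv h).cont z hz).mono hsub).intervalIntegrable, preSer_half]
  ring

theorem moderate_preSer (hU : IsOpen U) (hg : FuchsianFamily U g) (w : List ℕ) :
    Moderate U fun z s => preSer (g z) s w := by
  induction hn : w.length using Nat.strong_induction_on generalizing w with
  | _ n ih =>
    have h : ∀ v : List ℕ, v.length < w.length → Moderate U fun z s => preSer (g z) s v :=
      fun v hv => ih v.length (hn ▸ hv) v rfl
    exact ((Moderate.const U _).add ((hg.moderate_deriv h).integral hU).neg).congr hU
      fun z hz t ht => hg.preSer_eq_integral h hz ht

/-- The regularized limit of `preSer`. -/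
def limit (g : ℕ → ℝ → ℂ) : Ser ℕ := ⟨fun w => (1 : Ser ℕ) w + -∫ s in (0 : ℝ)..(1 / 2),
  (leftConn g s * preSer g s + preSer g s * rightConn g s) w⟩

theorem tendsto_preSer (hU : IsOpen U) (hg : FuchsianFamily U g) (w : List ℕ) {z : ℂ} (hz : z ∈ U) :
    Tendsto (fun t => preSer (g z) t w) (𝓝[>] 0) (𝓝 (limit (g z) w)) := by
  have h1 := hg.moderate_deriv (w := w) fun v _ => hg.moderate_preSer hU v
  refine ((h1.tendsto_integral hz).neg.const_add _).congr' ?_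
  filter_upwards [Ioc_mem_nhdsGT (by norm_num : (0 : ℝ) < 1 / 2)] with t ht
  exact (hg.preSer_eq_integral (fun v _ => hg.moderate_preSer hU v) hz ht).symm

theorem differentiableOn_limit (hU : IsOpen U) (hg : FuchsianFamily U g) (w : List ℕ) :
    DifferentiableOn ℂ (fun z => limit (g z) w) U := by
  have h1 := hg.moderate_deriv (w := w) fun v _ => hg.moderate_preSer hU v
  exact (differentiableOn_const _).add (h1.differentiableOn_integral hU le_rfl (by norm_num)).neg

/-- Each shuffle relation is a polynomial identity in finitely many coefficients, so it passes to
the limit. -/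
theorem isChar_limit (hU : IsOpen U) (hg : FuchsianFamily U g) {z : ℂ} (hz : z ∈ U) :
    IsChar (limit (g z)) := by
  intro u v
  have h1 : Tendsto (fun t => shSum (preSer (g z) t) u v) (𝓝[>] 0)
      (𝓝 (shSum (limit (g z)) u v)) := by
    unfold shSum
    induction shuffle u v with
    | nil => simp
    | cons w l ih =>
      simp only [List.map_cons, List.sum_cons]
      exact (hg.tendsto_preSer hU w hz).add ih
  refine tendsto_nhds_unique h1 (((hg.tendsto_preSer hU u hz).mul (hg.tendsto_preSer hU v hz)).congr' ?_)
  filter_upwards [Ioo_mem_nhdsGT (by norm_num : (0 : ℝ) < 1)] with t ht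
  exact (isChar_preSer (hg.cont z hz) ht u v).symm

theorem limit_nil (hU : IsOpen U) (hg : FuchsianFamily U g) {z : ℂ} (hz : z ∈ U) :
    limit (g z) [] = 1 :=
  tendsto_nhds_unique (hg.tendsto_preSer hU [] hz) (by simp only [preSer_nil]; exact tendsto_const_nhds)

end FuchsianFamily

end EllMZV

namespace EllMZV

open Ser

/-! ### The A-elliptic multiple zeta values -/

theorem f_ofComplex {z : ℂ} (hz : 0 < z.im) (n : ℕ) {s : ℝ} (hs : s ∈ Set.Ioo (0 : ℝ) 1) :
    f (ofComplex z) n s = fC z n s := by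
  rw [f_ofReal _ _ hs, ofComplex_apply_of_im_pos hz]

theorem fuchsianFamily_f :
    FuchsianFamily {z : ℂ | 0 < z.im} fun z n s => f (ofComplex z) n s := by
  have hU := isOpen_im_pos
  refine ⟨fun z hz n => (continuousOn_fC hz n).congr fun s hs => f_ofComplex hz n hs,
    fun n s hs z hz => ?_, fun z₀ hz₀ n => ?_, fun z₀ hz₀ n => ?_⟩
  · exact (differentiableAt_fC hz n hs).differentiableWithinAt.congr
      (fun z hz => f_ofComplex hz n hs) (f_ofComplex hz n hs)
  · obtain ⟨C, hC⟩ := exists_norm_fC_sub_le hz₀ n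
    refine ⟨C, (hC.and (hU.mem_nhds hz₀)).mono fun z hz s hs => ?_⟩
    rw [f_ofComplex hz.2 n ⟨hs.1, by linarith [hs.2]⟩]
    exact hz.1 s hs
  · obtain ⟨C, hC⟩ := exists_norm_fC_sub_le hz₀ n
    refine ⟨C, (hC.and (hU.mem_nhds hz₀)).mono fun z hz s hs => ?_⟩
    rw [f_ofComplex hz.2 n ⟨by linarith [hs.2], by linarith [hs.1]⟩, Complex.ofReal_sub,
      Complex.ofReal_one, fC_one_sub]
    refine le_of_eq_of_le ?_ (hz.1 s hs)
    -- For `n = 1` the reflection sign `-1` turns the residue at `0` into the opposite one at `1`;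
    -- for the other `n` there is no pole and the sign disappears in the norm.
    rcases eq_or_ne n 1 with rfl | hn
    · rw [← norm_neg]
      congr 1
      simp [atOne, neg_add_eq_sub]
    · simp [atOne, hn]

/-- The generating series of the A-elliptic multiple zeta values. -/
def limitSer (τ : ℍ) : Ser ℕ := FuchsianFamily.limit fun n s => f τ n s

/-- A word in `x, y` receives contributions from finitely many sequences only, so convergence
transfers through `phi`. -/
theorem tendsto_preSeries (τ : ℍ) (w : List Letter) :
    Tendsto (fun t : ℝ => preSeries τ t w) (𝓝[>] 0) (𝓝 (phi (limitSer τ) w)) := by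
  have hcont := fuchsianFamily_f.cont (τ : ℂ) τ.im_pos
  have hlim := fun ns => fuchsianFamily_f.tendsto_preSer isOpen_im_pos ns (z := τ) τ.im_pos
  simp only [ofComplex_apply] at hcont hlim
  have h1 : Tendsto (fun t : ℝ => ∑ ns ∈ degLE w.length,
      preSer (fun n s => f τ n s) t ns * adMonomial ns w) (𝓝[>] 0)
      (𝓝 (∑ ns ∈ degLE w.length, limitSer τ ns * adMonomial ns w)) :=
    tendsto_finsetSum _ fun ns _ => (hlim ns).mul_const _
  rw [phi_eq_sum _ le_rfl]
  refine h1.congr' ?_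
  filter_upwards [Ioo_mem_nhdsGT (by norm_num : (0 : ℝ) < 1)] with t ht
  rw [preSeries_eq hcont ht, phi_eq_sum _ le_rfl]

theorem regSeries_eq (τ : ℍ) : regSeries τ = phi (limitSer τ) :=
  funext fun w => (tendsto_preSeries τ w).limUnder_eq

theorem IA_apply (ns : List ℕ) (τ : ℍ) : IA ns τ = limitSer τ ns := by
  rw [IA, regSeries_eq, adCoeff_phi]

theorem IA_nil : IA [] = 1 := by
  funext τ
  rw [IA_apply]
  have := fuchsianFamily_f.limit_nil isOpen_im_pos (z := τ) τ.im_pos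
  simp only [ofComplex_apply] at this
  exact this

theorem IA_mul (u v : List ℕ) : IA u * IA v = ((shuffle u v).map IA).sum := by
  funext τ
  have h := fuchsianFamily_f.isChar_limit isOpen_im_pos (z := τ) τ.im_pos u v
  simp only [ofComplex_apply] at h
  rw [Pi.mul_apply, IA_apply, IA_apply]
  refine h.symm.trans ?_
  rw [shSum]
  induction shuffle u v with
  | nil => rfl
  | cons w l ih =>
    simp only [List.map_cons, List.sum_cons, Pi.add_apply, IA_apply, ← ih]
    rfl

theorem IA_mem_holo (ns : List ℕ) : IA ns ∈ holo := by
  change MDifferentiable 𝓘(ℂ) 𝓘(ℂ) (IA ns)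
  rw [UpperHalfPlane.mdifferentiable_iff]
  refine (fuchsianFamily_f.differentiableOn_limit isOpen_im_pos ns).congr fun z _ => ?_
  rw [Function.comp, IA_apply]
  rfl

/-! ### Weights, lengths and filtrations -/

theorem sum_and_length_of_mem_shuffle {u v w : List ℕ} (h : w ∈ shuffle u v) :
    w.sum = u.sum + v.sum ∧ w.length = u.length + v.length := by
  induction hn : u.length + v.length using Nat.strong_induction_on generalizing u v w with
  | _ n ih =>
    subst hn
    rcases u with _ | ⟨a, u⟩
    · simp_all
    rcases v with _ | ⟨b, v⟩
    · simp_all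
    rw [shuffle_cons_cons, List.mem_append, List.mem_map, List.mem_map] at h
    rcases h with ⟨w, hw, rfl⟩ | ⟨w, hw, rfl⟩
    · have := ih (u.length + (b :: v).length) (by simp) hw rfl
      simp only [List.sum_cons, List.length_cons] at this ⊢
      omega
    · have := ih ((a :: u).length + v.length) (by simp) hw rfl
      simp only [List.sum_cons, List.length_cons] at this ⊢
      omega

/-- Shuffle products have non-negative integer coefficients, so each inclusion of rational spans
reduces to a condition on index sets. Multiplicativity of `EZ`, `LEZw` and `LEZ` are three
instances. -/
theorem span_IA_mul_le {A B C : Set (List ℕ)}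
    (h : ∀ u ∈ A, ∀ v ∈ B, ∀ w ∈ shuffle u v, w ∈ C) :
    Submodule.span ℚ (IA '' A) * Submodule.span ℚ (IA '' B) ≤ Submodule.span ℚ (IA '' C) := by
  rw [Submodule.span_mul_span, Submodule.span_le]
  rintro _ ⟨_, ⟨u, hu, rfl⟩, _, ⟨v, hv, rfl⟩, rfl⟩
  change IA u * IA v ∈ Submodule.span ℚ (IA '' C)
  rw [IA_mul]
  refine list_sum_mem fun x hx => ?_
  obtain ⟨w, hw, rfl⟩ := List.mem_map.1 hx
  exact Submodule.subset_span ⟨w, h u hu v hv w hw, rfl⟩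

theorem EZ_eq : EZ = Submodule.span ℚ (IA '' Set.univ) := by rw [EZ, Set.image_univ]

theorem EZ_mul_mem {x y : ℍ → ℂ} (hx : x ∈ EZ) (hy : y ∈ EZ) : x * y ∈ EZ := by
  have := span_IA_mul_le (A := Set.univ) (B := Set.univ) (C := Set.univ) fun _ _ _ _ _ _ => trivial
  rw [← EZ_eq] at this
  exact this (Submodule.mul_mem_mul hx hy)

theorem LEZw_mul_le (l l' N N' : ℕ) : LEZw l N * LEZw l' N' ≤ LEZw (l + l') (N + N') :=
  span_IA_mul_le fun u hu v hv w hw => by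
    obtain ⟨h1, h2⟩ := sum_and_length_of_mem_shuffle hw
    obtain ⟨h3, h4⟩ := hu
    obtain ⟨h5, h6⟩ := hv
    exact ⟨by omega, by omega⟩

theorem LEZ_mul_le (l l' : ℕ) : LEZ l * LEZ l' ≤ LEZ (l + l') :=
  span_IA_mul_le fun u (hu : u.length ≤ l) v (hv : v.length ≤ l') w hw => by
    have := (sum_and_length_of_mem_shuffle hw).2
    change w.length ≤ l + l'
    omega

theorem LEZ_mono : Monotone LEZ := fun _ _ h =>
  Submodule.span_mono (Set.image_mono fun _ hns => le_trans hns h)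

theorem LEZw_mono (N : ℕ) : Monotone fun l => LEZw l N := fun _ _ h =>
  Submodule.span_mono (Set.image_mono fun _ hns => ⟨hns.1, hns.2.trans h⟩)

theorem iSup_LEZw (N : ℕ) : ⨆ l, LEZw l N = EZw N := by
  refine le_antisymm (iSup_le fun l => Submodule.span_mono (Set.image_mono fun _ hns => hns.1)) ?_
  rw [EZw, Submodule.span_le]
  rintro _ ⟨ns, hns, rfl⟩
  exact Submodule.mem_iSup_of_mem ns.length (Submodule.subset_span ⟨ns, ⟨hns, le_rfl⟩, rfl⟩)

theorem iSup_LEZ : ⨆ l, LEZ l = EZ := by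
  rw [EZ_eq]
  refine le_antisymm (iSup_le fun l => Submodule.span_mono (Set.image_mono fun _ _ => trivial)) ?_
  rw [Submodule.span_le]
  rintro _ ⟨ns, -, rfl⟩
  exact Submodule.mem_iSup_of_mem ns.length
    (Submodule.subset_span ⟨ns, (le_rfl : ns.length ≤ ns.length), rfl⟩)

theorem one_mem_LEZ_zero : (1 : ℍ → ℂ) ∈ LEZ 0 :=
  Submodule.subset_span ⟨[], (le_rfl : [].length ≤ 0), IA_nil⟩

theorem isRingFiltration_LEZ : IsRingFiltration LEZ (fun l => ⨆ i, ⨆ (_ : i < l), LEZ i) where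
  mono := LEZ_mono
  is_le {i _} h := le_iSup₂_of_le i h le_rfl
  is_sup _ _ h := iSup₂_le h
  one_mem := one_mem_LEZ_zero
  mul_mem _ _ _ _ hx hy := LEZ_mul_le _ _ (Submodule.mul_mem_mul hx hy)

theorem exists_subalgebra_eq_EZ : ∃ S : Subalgebra ℚ (ℍ → ℂ), Subalgebra.toSubmodule S = EZ ∧
    S ≤ holo.restrictScalars ℚ := by
  have h1 : (1 : ℍ → ℂ) ∈ EZ := Submodule.subset_span ⟨[], IA_nil⟩
  refine ⟨EZ.toSubalgebra h1 fun x y hx hy => EZ_mul_mem hx hy,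
    Submodule.toSubalgebra_toSubmodule _ _ _, fun x hx => ?_⟩
  have hle : EZ ≤ Subalgebra.toSubmodule (holo.restrictScalars ℚ) := by
    rw [EZ, Submodule.span_le]
    rintro _ ⟨ns, rfl⟩
    exact IA_mem_holo ns
  exact hle hx

theorem hasAdExpansion_regSeries (τ : ℍ) : HasAdExpansion (regSeries τ) (fun ns => IA ns τ) ∧
    ∀ c : List ℕ → ℂ, HasAdExpansion (regSeries τ) c → c = fun ns => IA ns τ := by
  have e : (fun ns => IA ns τ) = (limitSer τ).coeff := funext fun ns => IA_apply ns τ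
  rw [e, regSeries_eq]
  refine ⟨hasAdExpansion_iff.2 rfl, fun c hc => ?_⟩
  exact (congrArg coeff (phi_injective (hasAdExpansion_iff.1 hc))).symm

end EllMZV

end

theorem mainTheorem7 :
    -- the A-elliptic multiple zeta values are well defined: the regularizing limit exists, and
    -- the limit has a unique expansion in the products of the `ad^n(x)(y)`
    (∀ (τ : ℍ) (w : List EllMZV.Letter),
      Tendsto (fun t : ℝ => EllMZV.preSeries τ t w) (𝓝[>] 0) (𝓝 (EllMZV.regSeries τ w))) ∧
    (∀ τ : ℍ, EllMZV.HasAdExpansion (EllMZV.regSeries τ) (fun ns => EllMZV.IA ns τ) ∧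
      ∀ c : List ℕ → ℂ, EllMZV.HasAdExpansion (EllMZV.regSeries τ) c →
        c = fun ns => EllMZV.IA ns τ) ∧
    -- shuffle product
    (∀ u v : List ℕ,
      EllMZV.IA u * EllMZV.IA v = ((EllMZV.shuffle u v).map EllMZV.IA).sum) ∧
    -- `EZ^A` is a `ℚ`-subalgebra of `O(ℍ)`
    (∃ S : Subalgebra ℚ (ℍ → ℂ), Subalgebra.toSubmodule S = EllMZV.EZ ∧
      S ≤ EllMZV.holo.restrictScalars ℚ) ∧
    -- `L_l EZ^A_N · L_{l'} EZ^A_{N'} ⊆ L_{l+l'} EZ^A_{N+N'}`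
    (∀ l l' N N' : ℕ,
      EllMZV.LEZw l N * EllMZV.LEZw l' N' ≤ EllMZV.LEZw (l + l') (N + N')) ∧
    -- the lengths filter every weight component and the whole algebra `EZ^A`
    (∀ N : ℕ, Monotone (fun l => EllMZV.LEZw l N) ∧ (⨆ l, EllMZV.LEZw l N) = EllMZV.EZw N) ∧
    IsRingFiltration EllMZV.LEZ (fun l => ⨆ i, ⨆ (_ : i < l), EllMZV.LEZ i) ∧
    (⨆ l, EllMZV.LEZ l) = EllMZV.EZ := by
  exact ⟨fun τ w => by rw [EllMZV.regSeries_eq]; exact EllMZV.tendsto_preSeries τ w,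
    EllMZV.hasAdExpansion_regSeries, EllMZV.IA_mul, EllMZV.exists_subalgebra_eq_EZ,
    EllMZV.LEZw_mul_le, fun N => ⟨EllMZV.LEZw_mono N, EllMZV.iSup_LEZw N⟩,
    EllMZV.isRingFiltration_LEZ, EllMZV.iSup_LEZ⟩
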